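/- Let $A_\bullet$ be an abstract spin chain, that is, an inclusion-preserving assignment $I\mapsto A_I$ of finite-dimensional C$^*$-algebras, with unital inclusions, to the finite intervals $I\subset\mathbb{Z}$, such that $A_I$ and $A_J$ commute whenever $I\cap J=\varnothing$. Let $A=\varinjlim A_I$ be its quasi-local C$^*$-algebra, and for $F\subseteq\mathbb{Z}$ let $A_F\subseteq A$ be the C$^*$-subalgebra generated by the $A_I$ with $I\subseteq F$. Assume: (1) (weak algebraic Haag duality) there are $K,R\ge 0$ such that $A_{I^c}'\cap A\subseteq A_{I^{+R}}$ for every interval $I$ of length at least $K$, where $I^{+R}$ is the $R$-neighbourhood of $I$; (2) (covering property) there is $L>0$ such that $A_{I\cup J}=A_I\vee A_J$ whenever $I,J$ are intervals whose intersection contains an interval of length $L$; (3) (strong simplicity) $A$ is simple and has a unique tracial state. A vector $\xi$ in a C$^*$-correspondence $X$ over $A$ is localized in $F$ if $a\xi=\xi a$ for all $a\in A_{F^c}$. A projective basis of $X$ is a finite family $(\xi_i)_i$ in $X$ with $x=\sum_i\xi_i\langle\xi_i|x\rangle$ for all $x\in X$. A DHR bimodule is a dualizable C$^*$-correspondence $X$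 over $A$ for which there is $r\ge0$ such that for every interval $I$ of length at least $r$ there is a projective basis of $X$ localized in $I$. For a DHR bimodule $X$ and $x\in\mathbb{Z}$ let $X_{(-\infty,x-1]}$ be the right $A_{(-\infty,x-1]}$-submodule spanned by any projective basis of $X$ localized in a finite subset of $(-\infty,x-1-R-L]$, and let $X_{[x,\infty)}$ be the right $A_{[x,\infty)}$-submodule spanned by any projective basis of $X$ localized in a finite subset of $[x+R+L,\infty)$; by (1) and (2) these do not depend on the choice of the basis. Assume further: (4) (charge-transporter generation at every cut point) for every $x\in\mathbb{Z}$, the closed linear span of the elements $\langle\xi|\eta\rangle$, with $\xi\in X_{(-\infty,x-1]}$, $\eta\in X_{[x,\infty)}$ and $X$ a DHR bimodule, is all of $A$. Then for every DHR bimodule $X$, its dual (conjugate) bimodule $\overline{X}$ in the C$^*$-tensor category of C$^*$-correspondences over $A$ is again a DHR bimodule. -/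

import Mathlib

open MulOpposite

universe u

/-! ### Correspondences over a unital C*-algebra -/

/-- A C*-correspondence over the unital C*-algebra `A`: a complete right Hilbert `A`-module with an
`A`-valued inner product, conjugate linear in the first and right `A`-linear in the second variable,
together with a unital (that is, non-degenerate) `*`-homomorphism from `A` to the adjointable
operators. The right action of `a` on `x` is `op a • x`. -/
structure Correspondence (A : Type u) [CStarAlgebra A] where
  carrier : Type u
  [normedAddCommGroup : NormedAddCommGroup carrier]
  [normedSpace : NormedSpace ℂ carrier]
  [completeSpace : CompleteSpace carrier]
  [leftModule : Module A carrier]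
  [rightModule : Module Aᵐᵒᵖ carrier]
  [smulCommClass : SMulCommClass A Aᵐᵒᵖ carrier]
  [leftScalarTower : IsScalarTower ℂ A carrier]
  [rightScalarTower : IsScalarTower ℂ Aᵐᵒᵖ carrier]
  inner : carrier → carrier → A
  inner_add_right : ∀ x y z, inner x (y + z) = inner x y + inner x z
  inner_op_smul_right : ∀ (x y : carrier) (a : A), inner x (op a • y) = inner x y * a
  star_inner : ∀ x y, star (inner x y) = inner y x
  /-- `⟨x | x⟩` is a positive element of `A`. -/
  inner_self_nonneg : ∀ x, ∃ c : A, inner x x = star c * c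
  norm_sq_eq : ∀ x, ‖x‖ ^ 2 = ‖inner x x‖
  /-- `A` acts on the left by adjointable operators, with `a*` acting as the adjoint of `a`. -/
  inner_smul_left : ∀ (a : A) (x y : carrier), inner (a • x) y = inner x (star a • y)

namespace Correspondence

attribute [instance] normedAddCommGroup normedSpace completeSpace leftModule rightModule
  smulCommClass leftScalarTower rightScalarTower

variable {A : Type u} [CStarAlgebra A]

instance : CoeSort (Correspondence A) (Type u) := ⟨Correspondence.carrier⟩

variable (A) in
/-- The monoidal unit: `A` as a correspondence over itself, with `⟨a | b⟩ = a* b`. -/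
@[reducible] noncomputable def unit : Correspondence A where
  carrier := A
  inner a b := star a * b
  inner_add_right x y z := mul_add _ _ _
  inner_op_smul_right x y a := by simp [mul_assoc]
  star_inner x y := by simp
  inner_self_nonneg x := ⟨x, rfl⟩
  norm_sq_eq x := by rw [CStarRing.norm_star_mul_self, sq]
  inner_smul_left a x y := by simp [mul_assoc]

/-- Morphisms of correspondences: adjointable bimodule intertwiners (with their adjoint). -/
structure Hom (X Y : Correspondence A) where
  toFun : X →ₗ[ℂ] Y
  adj : Y →ₗ[ℂ] X
  map_left : ∀ (a : A) (x : X), toFun (a • x) = a • toFun x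
  map_right : ∀ (a : A) (x : X), toFun (op a • x) = op a • toFun x
  inner_toFun : ∀ (x : X) (y : Y), Y.inner (toFun x) y = X.inner x (adj y)

/-- A realization of the relative (interior) tensor product `X ⊠_A Y`: a correspondence containing
a total set of elementary tensors `x ⊠ y`, bilinear and `A`-balanced, with
`⟨x ⊠ y | x' ⊠ y'⟩ = ⟨y | ⟨x | x'⟩ y'⟩` and the outer left and right actions. This determines
`X ⊠_A Y` up to a unique unitary isomorphism that respects elementary tensors. -/
structure RelTensor (X Y : Correspondence A) where
  obj : Correspondence A
  tmul : X →ₗ[ℂ] Y →ₗ[ℂ] obj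
  tmul_balanced : ∀ (x : X) (a : A) (y : Y), tmul (op a • x) y = tmul x (a • y)
  smul_tmul : ∀ (a : A) (x : X) (y : Y), a • tmul x y = tmul (a • x) y
  op_smul_tmul : ∀ (a : A) (x : X) (y : Y), op a • tmul x y = tmul x (op a • y)
  inner_tmul : ∀ (x x' : X) (y y' : Y),
    obj.inner (tmul x y) (tmul x' y') = Y.inner y (X.inner x x' • y')
  dense_span : Dense (Submodule.span ℂ {z : obj | ∃ x y, z = tmul x y} : Set obj)

/-- The conjugate equation `(Q* ⊠ id_X) ∘ (id_X ⊠ P) = id_X` for morphisms `P : A → Y ⊠ X` and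
`Q : A → X ⊠ Y`. For fixed `x`, the left hand side sends `x` to the image of `P 1 ∈ Y ⊠ X` under
the bounded map `Φ : Y ⊠ X → X`, `y ⊠ x' ↦ Q*(x ⊠ y) x'`, which is `z ↦ (Q* ⊠ id_X) (x ⊠ z)`. -/
def ConjugateEquation {X Y : Correspondence A} (YX : RelTensor Y X) (XY : RelTensor X Y)
    (P : Hom (unit A) YX.obj) (Q : Hom (unit A) XY.obj) : Prop :=
  ∀ x : X, ∃ Φ : YX.obj →L[ℂ] X,
    (∀ (y : Y) (x' : X), Φ (YX.tmul y x') = (Q.adj (XY.tmul x y) : A) • x') ∧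
      Φ (P.toFun (1 : A)) = x

/-- `Y` is a dual (conjugate) of `X` in the C*-tensor category of correspondences: there are
morphisms `P : A → Y ⊠ X` and `Q : A → X ⊠ Y` that solve the conjugate equations
`(Q* ⊠ id_X) (id_X ⊠ P) = id_X` and `(P* ⊠ id_Y) (id_Y ⊠ Q) = id_Y`. -/
def IsDual (X Y : Correspondence A) : Prop :=
  ∃ (YX : RelTensor Y X) (XY : RelTensor X Y) (P : Hom (unit A) YX.obj) (Q : Hom (unit A) XY.obj),
    ConjugateEquation YX XY P Q ∧ ConjugateEquation XY YX Q P

/-- `X` is dualizable as a correspondence. -/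
def Dualizable (X : Correspondence A) : Prop := ∃ Y : Correspondence A, IsDual X Y

/-- A finite (right) projective basis: `x = ∑ i, ξ i ⟨ξ i | x⟩` for all `x`. -/
def IsProjectiveBasis (X : Correspondence A) {n : ℕ} (ξ : Fin n → X) : Prop :=
  ∀ x : X, x = ∑ i, op (X.inner (ξ i) x) • ξ i

end Correspondence

/-! ### Simplicity and traces -/

/-- A tracial state on `A`. -/
structure IsTracialState {A : Type u} [CStarAlgebra A] (τ : A →ₗ[ℂ] ℂ) : Prop where
  map_one : τ 1 = 1
  nonneg : ∀ a, ∃ t : ℝ, 0 ≤ t ∧ τ (star a * a) = t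
  tracial : ∀ a b, τ (a * b) = τ (b * a)

/-- Strong simplicity: `A` is simple and has a unique tracial state. (For a unital C*-algebra the
absence of closed ideals and of ideals that are not assumed closed are the same.) -/
def StronglySimple (A : Type u) [CStarAlgebra A] : Prop :=
  IsSimpleRing A ∧ ∃! τ : A →ₗ[ℂ] ℂ, IsTracialState τ

/-! ### Abstract spin chains -/

/-- An abstract spin chain, presented inside its quasi-local algebra `A`: an increasing family of
finite-dimensional unital `*`-subalgebras `A_I ⊆ A`, indexed by the (nonempty, bounded) discrete
intervals of `ℤ` ordered by inclusion, which commute for disjoint intervals and whose union is dense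
(so that `A` is the inductive limit of the `A_I` in the category of unital C*-algebras). -/
structure SpinChain (A : Type u) [CStarAlgebra A] where
  loc : NonemptyInterval ℤ → StarSubalgebra ℂ A
  finiteDimensional : ∀ I, FiniteDimensional ℂ (loc I)
  mono : ∀ I J, I ≤ J → loc I ≤ loc J
  commute : ∀ I J : NonemptyInterval ℤ, Disjoint (I : Set ℤ) (J : Set ℤ) →
    ∀ a ∈ loc I, ∀ b ∈ loc J, a * b = b * a
  dense : Dense (⋃ I, (loc I : Set A))

namespace SpinChain

/-- The number of sites of an interval, its length. -/
def numSites (I : NonemptyInterval ℤ) : ℤ := I.snd - I.fst + 1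

/-- The `R`-neighbourhood `F^{+R}` of a subset of `ℤ`. -/
def nbhd (R : ℕ) (F : Set ℤ) : Set ℤ := {z | ∃ y ∈ F, |z - y| ≤ R}

variable {A : Type u} [CStarAlgebra A] (S : SpinChain A)

/-- `A_F`, the C*-subalgebra of `A` generated by the `A_I` with `I ⊆ F`, for any `F ⊆ ℤ`. -/
noncomputable def alg (F : Set ℤ) : StarSubalgebra ℂ A :=
  (⨆ I : {I : NonemptyInterval ℤ // (I : Set ℤ) ⊆ F}, S.loc I).topologicalClosure

/-- Weak algebraic Haag duality with constants `K` and `R`: for every interval `I` of length at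
least `K`, every element of `A` that commutes with `A_{I^c}` lies in `A_{I^{+R}}`. -/
def WeakHaagDuality (K R : ℕ) : Prop :=
  ∀ I : NonemptyInterval ℤ, (K : ℤ) ≤ numSites I →
    ∀ a : A, (∀ b ∈ S.alg (I : Set ℤ)ᶜ, b * a = a * b) → a ∈ S.alg (nbhd R (I : Set ℤ))

/-- The covering property with constant `L`: if the intersection of the intervals `I` and `J`
contains an interval of length `L`, then `A_{I ∪ J}` is generated by `A_I` and `A_J`. -/
def CoveringProperty (L : ℕ) : Prop :=
  ∀ I J H : NonemptyInterval ℤ, (H : Set ℤ) ⊆ (I : Set ℤ) ∩ (J : Set ℤ) → numSites H = L →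
    S.alg ((I : Set ℤ) ∪ (J : Set ℤ)) = (S.loc I ⊔ S.loc J).topologicalClosure

/-- The vector `ξ` is localized in `F`: `a ξ = ξ a` for all `a ∈ A_{F^c}`. -/
def Localized (X : Correspondence A) (F : Set ℤ) (ξ : X) : Prop :=
  ∀ a ∈ S.alg Fᶜ, a • ξ = op a • ξ

/-- `X` is a DHR bimodule: it is dualizable and, for some `r`, it has a projective basis localized
in `I`, for every interval `I` of length at least `r`. -/
def IsDHR (X : Correspondence A) : Prop :=
  X.Dualizable ∧ ∃ r : ℕ, ∀ I : NonemptyInterval ℤ, (r : ℤ) ≤ numSites I →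
    ∃ (n : ℕ) (ξ : Fin n → X), X.IsProjectiveBasis ξ ∧ ∀ i, S.Localized X (I : Set ℤ) (ξ i)

/-- The span of the spaces `ξ_i A_F`, where `(ξ_i)` runs over the projective bases of `X` that are
localized in some finite subset of `G`. -/
def basisSpan (X : Correspondence A) (F G : Set ℤ) : Submodule ℂ X :=
  Submodule.span ℂ {x : X | ∃ (H : Set ℤ) (n : ℕ) (ξ : Fin n → X), H.Finite ∧ H ⊆ G ∧
    X.IsProjectiveBasis ξ ∧ (∀ i, S.Localized X H (ξ i)) ∧
    ∃ (i : Fin n), ∃ a ∈ S.alg F, x = op a • ξ i}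

/-- `X_{(-∞, x-1]}`, the right `A_{(-∞, x-1]}`-span of projective bases localized in finite subsets
of `(-∞, x-1-m]`. Here `m = R + L` for constants `R` of weak algebraic Haag duality and `L` of the
covering property; the span is then that of any single such basis. -/
def leftHalf (m : ℕ) (x : ℤ) (X : Correspondence A) : Submodule ℂ X :=
  S.basisSpan X (Set.Iic (x - 1)) (Set.Iic (x - 1 - m))

/-- `X_{[x, ∞)}`, the right `A_{[x, ∞)}`-span of projective bases localized in finite subsets
of `[x+m, ∞)`. -/
def rightHalf (m : ℕ) (x : ℤ) (X : Correspondence A) : Submodule ℂ X :=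
  S.basisSpan X (Set.Ici x) (Set.Ici (x + m))

/-- `C_x`, the closed linear span of the `⟨ξ | η⟩` with `ξ ∈ X_{(-∞, x-1]}` and `η ∈ X_{[x, ∞)}`,
for all DHR bimodules `X`. -/
noncomputable def transporterSpan (m : ℕ) (x : ℤ) : Submodule ℂ A :=
  (Submodule.span ℂ {c : A | ∃ X : Correspondence A, S.IsDHR X ∧
    ∃ ξ ∈ S.leftHalf m x X, ∃ η ∈ S.rightHalf m x X, c = X.inner ξ η}).topologicalClosure

/-- Charge-transporter generation at every cut point: `C_x = A` for all `x ∈ ℤ`. -/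
def ChargeTransporterGeneration (m : ℕ) : Prop :=
  ∀ x : ℤ, S.transporterSpan m x = ⊤

end SpinChain

/-! Write `Y` for the dual of `X`. The conjugate equations give an injective conjugation `J : X → Y`
that exchanges the two actions, so it carries vectors localized in `I` to vectors localized in `I`.
The difficulty is that `J` need not carry a right basis to a right basis: the conjugates of the
vectors localized in a given `I` might generate only a proper summand of `Y`. A trace computation
excludes this.

Let `B` be the commutant of `A_{I^c}`, finite-dimensional by Haag duality for large `I`, and let `V`
be the finite-dimensional `B`-bimodule of vectors of `X` localized in `I`. Gram-Schmidt over `B`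
turns `J V` into a localized family `y` for which `p = ∑ |y j⟩⟨y j|` is a projection fixing `J V`
(`exists_gramSchmidt`). For a family `x` put `φ_x a = ∑ τ ⟨x i | a x i⟩`. If `k ∈ B` is the density
of the trace `τ` with respect to the operator trace on `B` (`StarSubalgebra.exists_trace_density`),
the operator trace of `v ↦ k v k` on `V` equals both `φ_ξ k`, for a localized basis `ξ` of `X`, and
`φ_y k` (`IsSubBimodule.trace_bimul_right`, `IsSubBimodule.trace_bimul_left`).

For projective bases `φ` is tracial and independent of the basis, hence by uniqueness of the trace a
multiple of `τ`: `d τ` for `X` and `d' τ` for `Y`. Finitely many conjugates of boundedly localized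
vectors generate `Y` (`exists_generators`), so in one huge interval the family above is a basis `z`
of `Y`, and comparison at its `k` gives `d' = d`. For any other large `I`, the functional `φ_z -
φ_y` is positive, being the trace of the complement of `p`, and vanishes at `k`. The strict
positivity of `k` makes it vanish at `1`, and faithfulness of `τ` then gives `p = 1`. -/

namespace Correspondence

variable {A : Type u} [CStarAlgebra A]

/-! ### Inner product calculus, norm bounds and finite-rank operators -/

section Basic

variable (X : Correspondence A)

lemma complex_smul_eq_op (c : ℂ) (x : X) : c • x = op (c • (1 : A)) • x := by
  rw [op_smul, smul_assoc, op_one, one_smul]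

lemma complex_smul_eq_left (c : ℂ) (x : X) : c • x = (c • (1 : A)) • x := by
  rw [smul_assoc, one_smul]

lemma inner_smul_right (c : ℂ) (x y : X) : X.inner x (c • y) = c • X.inner x y := by
  rw [complex_smul_eq_op, X.inner_op_smul_right]; simp

/-- The inner product as a linear functional of the second variable. -/
def innerRight (x : X) : X →ₗ[ℂ] A where
  toFun := X.inner x
  map_add' := X.inner_add_right x
  map_smul' c y := X.inner_smul_right c x y

@[simp] lemma innerRight_apply (x y : X) : X.innerRight x y = X.inner x y := rfl

@[simp] lemma inner_zero_right (x : X) : X.inner x 0 = 0 := map_zero (X.innerRight x)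
lemma inner_sub_right (x y z : X) : X.inner x (y - z) = X.inner x y - X.inner x z :=
  map_sub (X.innerRight x) y z
lemma inner_sum_right {ι : Type*} (s : Finset ι) (x : X) (f : ι → X) :
    X.inner x (∑ i ∈ s, f i) = ∑ i ∈ s, X.inner x (f i) := map_sum (X.innerRight x) f s

lemma inner_add_left (x y z : X) : X.inner (x + y) z = X.inner x z + X.inner y z := by
  rw [← X.star_inner, X.inner_add_right, star_add, X.star_inner, X.star_inner]
@[simp] lemma inner_zero_left (x : X) : X.inner 0 x = 0 := by
  rw [← X.star_inner, inner_zero_right, star_zero]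
lemma inner_sub_left (x y z : X) : X.inner (x - y) z = X.inner x z - X.inner y z := by
  rw [← X.star_inner, inner_sub_right, star_sub, X.star_inner, X.star_inner]
lemma inner_sum_left {ι : Type*} (s : Finset ι) (x : X) (f : ι → X) :
    X.inner (∑ i ∈ s, f i) x = ∑ i ∈ s, X.inner (f i) x := by
  rw [← X.star_inner, inner_sum_right, star_sum]; simp_rw [X.star_inner]
lemma inner_op_smul_left (x y : X) (a : A) : X.inner (op a • x) y = star a * X.inner x y := by
  rw [← X.star_inner, X.inner_op_smul_right, star_mul, X.star_inner]
lemma inner_smul_right_eq (a : A) (x y : X) : X.inner x (a • y) = X.inner (star a • x) y := by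
  rw [X.inner_smul_left, star_star]
lemma inner_complex_smul_left (c : ℂ) (x y : X) :
    X.inner (c • x) y = star c • X.inner x y := by
  rw [← X.star_inner, inner_smul_right, star_smul, X.star_inner]

lemma smul_op_smul (a b : A) (x : X) : a • op b • x = op b • a • x := smul_comm a (op b) x

variable {X}

lemma eq_zero_of_inner_self {x : X} (h : X.inner x x = 0) : x = 0 := by
  have := X.norm_sq_eq x
  rw [h, norm_zero] at this
  exact norm_eq_zero.1 (pow_eq_zero_iff two_ne_zero |>.1 this)

lemma ext_inner {x y : X} (h : ∀ z, X.inner z x = X.inner z y) : x = y := by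
  rw [← sub_eq_zero]
  apply eq_zero_of_inner_self
  rw [inner_sub_right, h, sub_self]

variable (X)

lemma norm_op_smul_le (a : A) (x : X) : ‖op a • x‖ ≤ ‖a‖ * ‖x‖ := by
  refine le_of_sq_le_sq ?_ (by positivity)
  rw [X.norm_sq_eq, X.inner_op_smul_right, inner_op_smul_left, mul_pow, X.norm_sq_eq]
  calc _ ≤ ‖star a‖ * ‖X.inner x x‖ * ‖a‖ :=
        (norm_mul_le _ _).trans (by gcongr; exact norm_mul_le _ _)
    _ = _ := by rw [norm_star]; ring

/-- Writing `‖a‖² - a* a = b* b` gives `⟨a x | a x⟩ + ⟨b x | b x⟩ = ‖a‖² ⟨x | x⟩`, and the second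
summand is positive. -/
lemma norm_smul_le (a : A) (x : X) : ‖a • x‖ ≤ ‖a‖ * ‖x‖ := by
  let _ := CStarAlgebra.spectralOrder A
  let _ := CStarAlgebra.spectralOrderedRing A
  refine le_of_sq_le_sq ?_ (by positivity)
  have h1 : star a * a ≤ algebraMap ℝ A (‖a‖ ^ 2) := CStarAlgebra.star_mul_le_algebraMap_norm_sq
  obtain ⟨b, hb⟩ := CStarAlgebra.nonneg_iff_eq_star_mul_self.1 (sub_nonneg.2 h1)
  have h2 : X.inner (a • x) (a • x) + X.inner (b • x) (b • x) =
      ((‖a‖ ^ 2 : ℝ) : ℂ) • X.inner x x := by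
    rw [X.inner_smul_left, X.inner_smul_left, ← X.inner_add_right, smul_smul, smul_smul,
      ← add_smul, ← hb, add_sub_cancel, ← inner_smul_right, complex_smul_eq_left]
    rw [Complex.coe_smul, Algebra.algebraMap_eq_smul_one]
  have pos (y : X) : 0 ≤ X.inner y y := by
    obtain ⟨c, hc⟩ := X.inner_self_nonneg y
    rw [hc]; exact star_mul_self_nonneg c
  rw [X.norm_sq_eq, mul_pow, X.norm_sq_eq]
  calc _ ≤ ‖((‖a‖ ^ 2 : ℝ) : ℂ) • X.inner x x‖ :=
        CStarAlgebra.norm_le_norm_of_nonneg_of_le (pos _) (by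
          rw [← h2]; exact le_add_of_nonneg_right (pos _))
    _ = _ := by rw [norm_smul]; simp

/-- The Cauchy-Schwarz inequality. -/
lemma norm_inner_le (x y : X) : ‖X.inner x y‖ ≤ ‖x‖ * ‖y‖ := by
  let _ := CStarAlgebra.spectralOrder A
  let _ := CStarAlgebra.spectralOrderedRing A
  have pos (y : X) : 0 ≤ X.inner y y := by
    obtain ⟨c, hc⟩ := X.inner_self_nonneg y
    rw [hc]; exact star_mul_self_nonneg c
  rcases eq_or_ne x 0 with rfl | hx
  · simp
  set b := X.inner x y with hb
  set t : ℝ := ‖x‖ ^ 2 with ht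
  have htpos : 0 < t := by positivity
  -- Positivity at `x b - t y` with `b = ⟨x | y⟩` and `t = ‖x‖²`; with `b* ⟨x | x⟩ b ≤ t b* b` it
  -- yields `b* b ≤ t ⟨y | y⟩`.
  have h1 := pos (op b • x - (t : ℂ) • y)
  have h2 : star b * X.inner x x * b ≤ t • (star b * b) := by
    rw [ht, X.norm_sq_eq]
    exact CStarAlgebra.star_left_conjugate_le_norm_smul (hb := X.star_inner x x)
  have h3 : X.inner (op b • x - (t : ℂ) • y) (op b • x - (t : ℂ) • y) =
      star b * X.inner x x * b - t • (star b * b) - t • (star b * b)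
        + t • (t • X.inner y y) := by
    have : X.inner y x = star b := by rw [hb, X.star_inner]
    simp only [inner_sub_left, inner_sub_right, X.inner_op_smul_right, inner_op_smul_left,
      inner_smul_right, inner_complex_smul_left, this, ← hb]
    simp only [mul_assoc, sub_mul, Complex.star_def, Complex.conj_ofReal, Complex.coe_smul,
      smul_mul_assoc, smul_sub]
    abel
  rw [h3] at h1
  have h4 : t • (star b * b) ≤ t • (t • X.inner y y) := by
    rw [← sub_nonneg]
    refine h1.trans ?_
    calc _ ≤ t • (star b * b) - t • (star b * b) - t • (star b * b)
            + t • (t • X.inner y y) := by gcongr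
      _ = _ := by abel
  rw [smul_le_smul_iff_of_pos_left htpos] at h4
  have h5 := CStarAlgebra.norm_le_norm_of_nonneg_of_le (star_mul_self_nonneg b) h4
  rw [CStarRing.norm_star_mul_self, norm_smul, ← X.norm_sq_eq, Real.norm_of_nonneg htpos.le] at h5
  refine le_of_sq_le_sq ?_ (by positivity)
  rw [mul_pow]; nlinarith

/-- The inner product as a bounded functional of the second variable. -/
noncomputable def innerRightL (x : X) : X →L[ℂ] A :=
  (X.innerRight x).mkContinuous ‖x‖ (X.norm_inner_le x)

@[simp] lemma innerRightL_apply (x y : X) : X.innerRightL x y = X.inner x y := rfl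

/-- The vector `ξ a` as a bounded linear function of `a`. -/
noncomputable def rightMul (x : X) : A →L[ℂ] X :=
  LinearMap.mkContinuous
    { toFun := fun a => op a • x
      map_add' := fun a b => by rw [op_add, add_smul]
      map_smul' := fun c a => by rw [op_smul, smul_assoc]; rfl } ‖x‖
    (fun a => by rw [mul_comm]; exact X.norm_op_smul_le a x)

@[simp] lemma rightMul_apply (x : X) (a : A) : X.rightMul x a = op a • x := rfl

/-- The left action of an element of `A` as a linear map. -/
def leftMul (a : A) : X →ₗ[ℂ] X where
  toFun x := a • x
  map_add' := smul_add a
  map_smul' c x := by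
    rw [complex_smul_eq_op, smul_op_smul, ← complex_smul_eq_op]; rfl

/-- The right action of an element of `A` as a linear map. -/
def rightAct (a : A) : X →ₗ[ℂ] X where
  toFun x := op a • x
  map_add' := smul_add _
  map_smul' c x := by
    rw [complex_smul_eq_left, ← smul_op_smul, ← complex_smul_eq_left]; rfl

/-- The operator `∑ i, |x i⟩⟨y i|`. -/
noncomputable def ketBra {n : ℕ} (x y : Fin n → X) : X →L[ℂ] X :=
  ∑ i, (X.rightMul (x i)).comp (X.innerRightL (y i))

lemma ketBra_apply {n : ℕ} (x y : Fin n → X) (z : X) :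
    X.ketBra x y z = ∑ i, op (X.inner (y i) z) • x i := by
  simp [ketBra]

lemma ketBra_op_smul {n : ℕ} (x y : Fin n → X) (z : X) (a : A) :
    X.ketBra x y (op a • z) = op a • X.ketBra x y z := by
  simp_rw [ketBra_apply, Finset.smul_sum, X.inner_op_smul_right, op_smul_op_smul]

lemma inner_ketBra_self {n : ℕ} (y : Fin n → X) (v w : X) :
    X.inner (X.ketBra y y v) w = X.inner v (X.ketBra y y w) := by
  simp_rw [ketBra_apply, inner_sum_left, inner_sum_right, inner_op_smul_left,
    X.inner_op_smul_right, X.star_inner]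

lemma isProjectiveBasis_iff {n : ℕ} (y : Fin n → X) :
    X.IsProjectiveBasis y ↔ ∀ z, X.ketBra y y z = z := by
  simp_rw [IsProjectiveBasis, ketBra_apply, eq_comm]

end Basic

/-! ### Contraction of a tensor with a vector -/

namespace RelTensor

variable {X Y : Correspondence A} (T : RelTensor X Y)

lemma norm_tmul_le (x : X) (y : Y) : ‖T.tmul x y‖ ≤ ‖x‖ * ‖y‖ := by
  refine le_of_sq_le_sq ?_ (by positivity)
  rw [T.obj.norm_sq_eq, T.inner_tmul]
  calc _ ≤ ‖y‖ * (‖X.inner x x‖ * ‖y‖) := (Y.norm_inner_le _ _).trans (by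
          gcongr; exact Y.norm_smul_le _ _)
    _ = _ := by rw [← X.norm_sq_eq]; ring

lemma norm_le_of_contract {x : X} {z : T.obj} {s : Y}
    (h : ∀ y, Y.inner y s = T.obj.inner (T.tmul x y) z) : ‖s‖ ≤ ‖x‖ * ‖z‖ := by
  have h1 : ‖s‖ * ‖s‖ ≤ (‖x‖ * ‖z‖) * ‖s‖ := by
    rw [← sq, Y.norm_sq_eq, h]
    calc _ ≤ ‖x‖ * ‖s‖ * ‖z‖ := (T.obj.norm_inner_le _ _).trans (by
          gcongr; exact T.norm_tmul_le _ _)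
      _ = _ := by ring
  rcases (norm_nonneg s).eq_or_lt with h0 | h0
  · rw [← h0]; positivity
  · exact le_of_mul_le_mul_right h1 h0

/-- This is the adjoint of `y ↦ x ⊠ y` applied to `z`. It is explicit on elementary tensors, and the
bound `norm_le_of_contract` with completeness of `Y` extends it to limits. -/
lemma exists_contract (x : X) (z : T.obj) :
    ∃ s : Y, ∀ y, Y.inner y s = T.obj.inner (T.tmul x y) z := by
  let C : Submodule ℂ T.obj :=
    { carrier := {z | ∃ s : Y, ∀ y, Y.inner y s = T.obj.inner (T.tmul x y) z}
      add_mem' := by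
        rintro z w ⟨s, hs⟩ ⟨t, ht⟩
        exact ⟨s + t, fun y => by rw [Y.inner_add_right, hs, ht, T.obj.inner_add_right]⟩
      zero_mem' := ⟨0, fun y => by simp⟩
      smul_mem' := by
        rintro c z ⟨s, hs⟩
        exact ⟨c • s, fun y => by rw [inner_smul_right, hs, inner_smul_right]⟩ }
  have hspan : Submodule.span ℂ {z : T.obj | ∃ x y, z = T.tmul x y} ≤ C := by
    refine Submodule.span_le.2 ?_
    rintro _ ⟨x', y', rfl⟩
    exact ⟨X.inner x x' • y', fun y => (T.inner_tmul _ _ _ _).symm⟩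
  have hz : z ∈ closure (C : Set T.obj) := closure_mono hspan (T.dense_span z)
  obtain ⟨t, ht, hlim⟩ := mem_closure_iff_seq_limit.1 hz
  choose s hs using ht
  have hsub (m n : ℕ) : ‖s m - s n‖ ≤ ‖x‖ * ‖t m - t n‖ := by
    apply T.norm_le_of_contract
    intro y
    rw [inner_sub_right, hs, hs, inner_sub_right]
  have hc : CauchySeq s := by
    have h1 := hlim.cauchySeq
    rw [Metric.cauchySeq_iff] at h1 ⊢
    intro ε hε
    obtain ⟨N, hN⟩ := h1 (ε / (‖x‖ + 1)) (by positivity)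
    refine ⟨N, fun m hm n hn => ?_⟩
    have h2 := hN m hm n hn
    rw [dist_eq_norm, lt_div_iff₀ (by positivity)] at h2
    rw [dist_eq_norm]
    have := hsub m n
    nlinarith [norm_nonneg (t m - t n), norm_nonneg x]
  obtain ⟨s', hs'⟩ := cauchySeq_tendsto_of_complete hc
  refine ⟨s', fun y => ?_⟩
  have h1 := ((Y.innerRightL y).continuous.tendsto _).comp hs'
  have h2 := ((T.obj.innerRightL (T.tmul x y)).continuous.tendsto _).comp hlim
  refine tendsto_nhds_unique h1 (h2.congr fun n => ?_)
  simp [hs]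

end RelTensor

end Correspondence

namespace Correspondence

variable {A : Type u} [CStarAlgebra A]

/-! ### The conjugation of a correspondence onto its dual -/

/-- An injective conjugate linear map `X → Y` that interchanges the left and the right action. -/
structure Conjugation (X Y : Correspondence A) extends X →+ Y where
  map_left : ∀ (a : A) (x : X), toFun (a • x) = op (star a) • toFun x
  map_right : ∀ (a : A) (x : X), toFun (op a • x) = star a • toFun x
  injective : Function.Injective toFun

namespace Conjugation

variable {X Y : Correspondence A}

instance : FunLike (Conjugation X Y) X Y where
  coe J := J.toFun
  coe_injective := by
    intro J J' h
    cases J; cases J'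
    congr
    exact DFunLike.coe_injective h

instance : AddMonoidHomClass (Conjugation X Y) X Y where
  map_add J := J.map_add'
  map_zero J := J.map_zero'

variable (J : Conjugation X Y)

lemma map_smul_left (a : A) (x : X) : J (a • x) = op (star a) • J x := J.map_left a x
lemma map_op_smul (a : A) (x : X) : J (op a • x) = star a • J x := J.map_right a x

end Conjugation

lemma Hom.inner_toFun_one {X : Correspondence A} (P : Hom (unit A) X) (z : X) :
    X.inner (P.toFun (1 : A)) z = P.adj z := by
  rw [P.inner_toFun]
  change star (1 : A) * P.adj z = P.adj z
  rw [star_one, one_mul]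

lemma Hom.smul_toFun_one {X : Correspondence A} (P : Hom (unit A) X) (a : A) :
    a • P.toFun (1 : A) = op a • P.toFun (1 : A) := by
  rw [← P.map_left, ← P.map_right]
  congr 1
  change a * 1 = 1 * a
  rw [mul_one, one_mul]

section IsDual

variable {X Y : Correspondence A} {YX : RelTensor Y X} {XY : RelTensor X Y}
  {P : Hom (unit A) YX.obj} {Q : Hom (unit A) XY.obj}

/-- The conjugation `x ↦ (⟨x| ⊠ id) (Q 1)` of a solution of the conjugate equations. -/
noncomputable def conjugation (h : ConjugateEquation YX XY P Q) : Conjugation X Y where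
  toFun x := (XY.exists_contract x (Q.toFun (1 : A))).choose
  map_zero' := by
    refine ext_inner fun y => ?_
    rw [(XY.exists_contract 0 _).choose_spec y]
    simp
  map_add' x x' := by
    refine ext_inner fun y => ?_
    rw [Y.inner_add_right, (XY.exists_contract _ _).choose_spec y,
      (XY.exists_contract _ _).choose_spec y, (XY.exists_contract _ _).choose_spec y,
      map_add, LinearMap.add_apply, inner_add_left]
  map_left a x := by
    refine ext_inner fun y => ?_
    rw [Y.inner_op_smul_right, (XY.exists_contract _ _).choose_spec y,
      (XY.exists_contract _ _).choose_spec y, ← XY.smul_tmul, XY.obj.inner_smul_left,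
      Q.smul_toFun_one, XY.obj.inner_op_smul_right]
  map_right a x := by
    refine ext_inner fun y => ?_
    rw [inner_smul_right_eq, (XY.exists_contract _ _).choose_spec y,
      (XY.exists_contract _ _).choose_spec, XY.tmul_balanced, star_star]
  injective := by
    intro x x' hx
    obtain ⟨Φ, hΦ, h1⟩ := h (x - x')
    -- The coefficient `Q*((x - x') ⊠ y)` depends only on `J (x - x')`, so `Φ` vanishes on all
    -- elementary tensors.
    have : Φ = 0 := by
      refine ContinuousLinearMap.ext_on YX.dense_span ?_
      rintro _ ⟨y, w, rfl⟩
      have h2 := (XY.exists_contract x (Q.toFun (1 : A))).choose_spec y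
      have h3 := (XY.exists_contract x' (Q.toFun (1 : A))).choose_spec y
      simp only at hx
      rw [hx] at h2
      rw [h2] at h3
      rw [hΦ, ← Q.inner_toFun_one, map_sub, LinearMap.sub_apply, inner_sub_right,
        ← XY.obj.star_inner, h3, XY.obj.star_inner, sub_self, zero_smul]
      rfl
    rw [this] at h1
    exact (sub_eq_zero.1 h1.symm)

lemma inner_conjugation (h : ConjugateEquation YX XY P Q) (x : X) (y : Y) :
    Y.inner y (conjugation h x) = XY.obj.inner (XY.tmul x y) (Q.toFun (1 : A)) :=
  (XY.exists_contract x (Q.toFun (1 : A))).choose_spec y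

lemma norm_conjugation_le (h : ConjugateEquation YX XY P Q) (x : X) :
    ‖conjugation h x‖ ≤ ‖x‖ * ‖Q.toFun (1 : A)‖ :=
  XY.norm_le_of_contract (inner_conjugation h x)

/-- Pairing the map of the second conjugate equation with `y'` is, on elementary tensors, the
functional `⟨J' y ⊠ y' | ·⟩`, where `J' : Y → X` is the conjugation from `P`. Evaluation at `Q 1`
gives the claim. -/
lemma conjugation_conjugation (h : ConjugateEquation YX XY P Q)
    (h' : ConjugateEquation XY YX Q P) (y : Y) : conjugation h (conjugation h' y) = y := by
  obtain ⟨Ψ, hΨ, h1⟩ := h' y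
  refine ext_inner fun y' => ?_
  rw [inner_conjugation]
  have : (Y.innerRightL y').comp Ψ = XY.obj.innerRightL (XY.tmul (conjugation h' y) y') := by
    refine ContinuousLinearMap.ext_on XY.dense_span ?_
    rintro _ ⟨x, y'', rfl⟩
    simp only [ContinuousLinearMap.comp_apply, innerRightL_apply]
    rw [hΨ, XY.inner_tmul, ← P.inner_toFun_one, ← YX.obj.star_inner, ← inner_conjugation h',
      X.star_inner]
  have h2 := DFunLike.congr_fun this (Q.toFun (1 : A))
  simp only [ContinuousLinearMap.comp_apply, innerRightL_apply] at h2
  rw [← h2, h1]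

/-! ### Finite generation of the dual by conjugates from a dense subspace -/

lemma RelTensor.dense_span_of_dense {X Y : Correspondence A} (T : RelTensor X Y)
    (D : Submodule ℂ Y) (hD : Dense (D : Set Y)) :
    Dense (Submodule.span ℂ {z : T.obj | ∃ x, ∃ y ∈ D, z = T.tmul x y} : Set T.obj) := by
  set E := Submodule.span ℂ {z : T.obj | ∃ x, ∃ y ∈ D, z = T.tmul x y}
  have key : Submodule.span ℂ {z : T.obj | ∃ x y, z = T.tmul x y} ≤ E.topologicalClosure := by
    refine Submodule.span_le.2 ?_
    rintro _ ⟨x, y, rfl⟩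
    let f : Y →L[ℂ] T.obj := (T.tmul x).mkContinuous ‖x‖ (T.norm_tmul_le x)
    have hy : y ∈ closure (D : Set Y) := hD y
    exact map_mem_closure f.continuous hy fun y hy => Submodule.subset_span ⟨x, y, hy, rfl⟩
  have h2 := T.dense_span.mono key
  rw [Submodule.topologicalClosure_coe] at h2
  exact dense_closure.1 h2

/-- Approximate `P 1` by a finite sum `t = ∑ y k ⊠ x k` with `x k ∈ D`. Contracting `P 1 - t` with
`v` and applying the conjugation turns `P 1` into `v` and `t` into the finite-rank operator at `v`.
-/
lemma exists_norm_sub_ketBra_le (h : ConjugateEquation YX XY P Q)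
    (h' : ConjugateEquation XY YX Q P) (D : Submodule ℂ X) (hD : Dense (D : Set X)) :
    ∃ (n : ℕ) (x : Fin n → X) (y : Fin n → Y), (∀ k, x k ∈ D) ∧
      ∀ v, ‖v - Y.ketBra (fun k => conjugation h (x k)) y v‖ ≤ 1 / 2 * ‖v‖ := by
  set q := Q.toFun (1 : A)
  set p := P.toFun (1 : A)
  obtain ⟨t, ht, hpt⟩ := Metric.mem_closure_iff.1 (YX.dense_span_of_dense D hD p)
    -- The conjugation has norm at most `‖q‖`, so this tolerance leaves a final error of at most
    -- `1/2`; the `+ 1` covers `q = 0`.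
    (1 / (2 * (‖q‖ + 1))) (by positivity)
  obtain ⟨n, c, g, hg⟩ := Submodule.mem_span_set'.1 ht
  choose y x hx hyx using fun i => (g i).2
  refine ⟨n, x, fun k => c k • y k, hx, fun v => ?_⟩
  set s := conjugation h' v - ∑ k, (Y.inner v (c k • y k)) • x k with hs
  have hs1 : ∀ w, X.inner w s = YX.obj.inner (YX.tmul v w) (p - t) := by
    intro w
    rw [hs, inner_sub_right, inner_conjugation, inner_sub_right, inner_sum_right, ← hg,
      inner_sum_right]
    congr 1
    refine Finset.sum_congr rfl fun k _ => ?_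
    rw [hyx, ← LinearMap.smul_apply, ← map_smul, YX.inner_tmul]
  have hs2 : ‖s‖ ≤ ‖v‖ * ‖p - t‖ := YX.norm_le_of_contract hs1
  have hs3 : conjugation h s =
      v - Y.ketBra (fun k => conjugation h (x k)) (fun k => c k • y k) v := by
    rw [hs, map_sub, conjugation_conjugation, map_sum, ketBra_apply]
    simp_rw [Conjugation.map_smul_left, Y.star_inner]
  rw [← hs3]
  refine (norm_conjugation_le h s).trans ?_
  rw [dist_eq_norm, lt_div_iff₀ (by positivity)] at hpt
  have h0 := norm_nonneg v
  have h1 := norm_nonneg q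
  have h2 := norm_nonneg (p - t)
  calc ‖s‖ * ‖q‖ ≤ (‖v‖ * ‖p - t‖) * (‖q‖ + 1) := by gcongr; linarith
    _ ≤ 1 / 2 * ‖v‖ := by nlinarith

/-- If a dual `Y` of `X` exists, any dense subspace of `X` contains a finite family whose conjugates
generate `Y` as a right `A`-module. -/
lemma exists_generators (h : ConjugateEquation YX XY P Q)
    (h' : ConjugateEquation XY YX Q P) (D : Submodule ℂ X) (hD : Dense (D : Set X)) :
    ∃ (n : ℕ) (x : Fin n → X), (∀ k, x k ∈ D) ∧
      ∀ v : Y, ∃ a : Fin n → A, v = ∑ k, op (a k) • conjugation h (x k) := by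
  obtain ⟨n, x, y, hx, hv⟩ := exists_norm_sub_ketBra_le h h' D hD
  refine ⟨n, x, hx, fun v => ?_⟩
  set θ := Y.ketBra (fun k => conjugation h (x k)) y
  -- A Neumann series inverts `θ`, so every vector is in the range of this finite-rank operator.
  have hθ : ‖1 - θ‖ < 1 := by
    refine lt_of_le_of_lt (ContinuousLinearMap.opNorm_le_bound _ (by norm_num) hv) ?_
    norm_num
  have hu : IsUnit θ := by
    have := (Units.oneSub (1 - θ) hθ).isUnit
    rwa [Units.val_oneSub, sub_sub_cancel] at this
  obtain ⟨θ', h1, -⟩ := isUnit_iff_exists.1 hu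
  refine ⟨fun k => Y.inner (y k) (θ' v), ?_⟩
  rw [← ketBra_apply]
  exact (DFunLike.congr_fun h1 v).symm

end IsDual

end Correspondence

/-! ### Positive functionals and faithful traces -/

section Functional

variable {A : Type u} [CStarAlgebra A]

/-- A linear functional that is nonnegative on the elements `a* a`. -/
def IsPositiveFunctional (ψ : A →ₗ[ℂ] ℂ) : Prop :=
  ∀ a, ∃ t : ℝ, 0 ≤ t ∧ ψ (star a * a) = t

/-- An affine function that stays nonnegative on the whole real line is constant. -/
lemma Complex.eq_zero_of_forall_add_mul_nonneg {c u : ℂ}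
    (h : ∀ s : ℝ, ∃ t : ℝ, 0 ≤ t ∧ c + s * u = t) : u = 0 := by
  have him : u.im = 0 := by
    obtain ⟨t, -, ht⟩ := h 0
    obtain ⟨t', -, ht'⟩ := h 1
    have h1 := congrArg Complex.im ht
    have h2 := congrArg Complex.im ht'
    simp at h1 h2
    linarith
  have hre : u.re = 0 := by
    by_contra hne
    obtain ⟨t, h0, ht⟩ := h (-(c.re + 1) / u.re)
    have h1 := congrArg Complex.re ht
    rw [Complex.add_re, Complex.re_ofReal_mul, Complex.ofReal_re, div_mul_cancel₀ _ hne] at h1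
    linarith
  exact Complex.ext hre him

namespace IsPositiveFunctional

variable {ψ : A →ₗ[ℂ] ℂ} (hψ : IsPositiveFunctional ψ)
include hψ

lemma map_star (a : A) : ψ (star a) = star (ψ a) := by
  obtain ⟨t, -, ht⟩ := hψ (1 + a)
  obtain ⟨t', -, ht'⟩ := hψ (1 + Complex.I • a)
  obtain ⟨r, -, hr⟩ := hψ a
  obtain ⟨r', -, hr'⟩ := hψ 1
  simp only [star_add, star_one, star_smul, add_mul, mul_add, one_mul, mul_one, map_add,
    smul_mul_assoc, mul_smul_comm, map_smul, hr] at ht ht' hr'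
  rw [hr'] at ht ht'
  have h1 := congrArg Complex.im ht
  have h2 := congrArg Complex.im ht'
  simp at h1 h2
  apply Complex.ext <;> simp <;> linarith

/-- The degenerate case of Cauchy-Schwarz: positivity at `b* + z a` loses its quadratic term in `z`,
and the linear term must vanish for real and for imaginary `z`. -/
lemma map_mul_eq_zero {a : A} (ha : ψ (star a * a) = 0) (b : A) : ψ (b * a) = 0 := by
  set u := ψ (b * a)
  set w := ψ (star a * star b)
  have hz (z : ℂ) : ∃ t : ℝ, 0 ≤ t ∧ ψ (b * star b) + (z * u + star z * w) = t := by
    obtain ⟨t, h0, ht⟩ := hψ (star b + z • a)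
    refine ⟨t, h0, ?_⟩
    rw [← ht]
    simp only [star_add, star_star, star_smul, add_mul, mul_add, map_add, smul_mul_assoc,
      mul_smul_comm, map_smul, ha, smul_eq_mul]
    ring
  have h1 : u + w = 0 := Complex.eq_zero_of_forall_add_mul_nonneg (c := ψ (b * star b)) fun s => by
    obtain ⟨t, h0, ht⟩ := hz s
    refine ⟨t, h0, ?_⟩
    rw [← ht, Complex.star_def, Complex.conj_ofReal]
    ring
  have h2 : Complex.I * (u - w) = 0 :=
    Complex.eq_zero_of_forall_add_mul_nonneg (c := ψ (b * star b)) fun s => by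
      obtain ⟨t, h0, ht⟩ := hz (s * Complex.I)
      refine ⟨t, h0, ?_⟩
      rw [← ht, Complex.star_def, map_mul (starRingEnd ℂ), Complex.conj_ofReal, Complex.conj_I]
      ring
  have h3 : u - w = 0 := (mul_eq_zero.1 h2).resolve_left Complex.I_ne_zero
  linear_combination (h1 + h3) / 2

end IsPositiveFunctional

lemma IsTracialState.isPositiveFunctional {τ : A →ₗ[ℂ] ℂ} (hτ : IsTracialState τ) :
    IsPositiveFunctional τ := hτ.nonneg

/-- A tracial state on a simple algebra is faithful. -/
lemma IsTracialState.faithful [IsSimpleRing A] {τ : A →ₗ[ℂ] ℂ} (hτ : IsTracialState τ) {a : A}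
    (ha : τ (star a * a) = 0) : a = 0 := by
  -- The null space of `τ` is a two-sided ideal by traciality, and it does not contain `1`.
  let I : TwoSidedIdeal A := TwoSidedIdeal.mk' {x | ∀ c, τ (c * x) = 0}
    (by intro c; simp)
    (by intro x y hx hy c; rw [mul_add, map_add, hx, hy, add_zero])
    (by intro x hx c; rw [mul_neg, map_neg, hx, neg_zero])
    (by intro x y hy c; rw [← mul_assoc]; exact hy _)
    (by intro x y hx c; rw [← mul_assoc, hτ.tracial, ← mul_assoc]; exact hx _)
  have hmem : ∀ x, x ∈ I ↔ ∀ c, τ (c * x) = 0 := fun x => by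
    simp only [I, TwoSidedIdeal.mem_mk', Set.mem_ofPred_eq]
  have haI : a ∈ I := (hmem a).2 (hτ.isPositiveFunctional.map_mul_eq_zero ha)
  rcases eq_bot_or_eq_top I with h | h
  · rw [h] at haI
    exact (TwoSidedIdeal.mem_bot A).1 haI
  · have h1 : (1 : A) ∈ I := by rw [h]; trivial
    have := (hmem 1).1 h1 1
    rw [mul_one, hτ.map_one] at this
    exact absurd this one_ne_zero

end Functional

/-! ### The density of a trace on a finite-dimensional algebra -/

section Density

lemma exists_orthonormal_expansion {V : Type*} [AddCommGroup V] [Module ℂ V]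
    [FiniteDimensional ℂ V] (f : V →ₗ⋆[ℂ] V →ₗ[ℂ] ℂ) (hf : ∀ x y, star (f y x) = f x y)
    (hpos : ∀ x, 0 ≤ (f x x).re) (hdef : ∀ x, f x x = 0 → x = 0) :
    ∃ (n : ℕ) (e : Fin n → V), ∀ v, v = ∑ i, f (e i) v • e i := by
  let core : InnerProductSpace.Core ℂ V :=
    { inner := fun x y => f x y
      conj_inner_symm := hf
      re_inner_nonneg := hpos
      add_left := fun x y z => by simp
      smul_left := fun x y r => by simp
      definite := hdef }
  let _ : NormedAddCommGroup V := core.toNormedAddCommGroup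
  let _ : InnerProductSpace ℂ V := InnerProductSpace.ofCore core.toCore
  let b := stdOrthonormalBasis ℂ V
  exact ⟨_, b, fun v => (b.sum_repr' v).symm⟩

/-- The expansion writes `T` as a sum of rank-one maps, so `e` need not be linearly independent. -/
lemma LinearMap.trace_eq_sum_of_expansion {V : Type*} [AddCommGroup V] [Module ℂ V]
    [FiniteDimensional ℂ V] {n : ℕ} (φ : Fin n → V →ₗ[ℂ] ℂ) (e : Fin n → V)
    (h : ∀ v, v = ∑ i, φ i v • e i) (T : V →ₗ[ℂ] V) :
    LinearMap.trace ℂ V T = ∑ i, φ i (T (e i)) := by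
  have hT : T = ∑ i, (φ i).smulRight (T (e i)) := by
    ext v
    conv_lhs => rw [h v]
    simp
  conv_lhs => rw [hT, map_sum]
  simp [LinearMap.trace_smulRight]

variable {A : Type u} [CStarAlgebra A]

/-- The functional `b ↦ τ (e b)` on a subalgebra. -/
noncomputable def StarSubalgebra.mulFunctional (B : StarSubalgebra ℂ A) (τ : A →ₗ[ℂ] ℂ) (e : A) :
    B →ₗ[ℂ] ℂ :=
  τ.comp ((LinearMap.mulLeft ℂ e).comp B.subtype.toLinearMap)

@[simp] lemma StarSubalgebra.mulFunctional_apply (B : StarSubalgebra ℂ A) (τ : A →ₗ[ℂ] ℂ) (e : A)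
    (b : B) : B.mulFunctional τ e b = τ (e * b) := rfl

lemma StarSubalgebra.exists_expansion (B : StarSubalgebra ℂ A) [FiniteDimensional ℂ B]
    {τ : A →ₗ[ℂ] ℂ} (hτ : IsPositiveFunctional τ) (hf : ∀ a, τ (star a * a) = 0 → a = 0) :
    ∃ (n : ℕ) (e : Fin n → B), ∀ b : B, b = ∑ i, τ (star (e i : A) * b) • e i := by
  let f : B →ₗ⋆[ℂ] B →ₗ[ℂ] ℂ :=
    { toFun := fun x => B.mulFunctional τ (star (x : A))
      map_add' := fun x y => by ext z; simp [add_mul]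
      map_smul' := fun c x => by ext z; simp }
  refine exists_orthonormal_expansion f (fun x y => ?_) (fun x => ?_) (fun x hx => ?_)
  · change star (τ (star (y : A) * x)) = τ (star (x : A) * y)
    rw [← hτ.map_star, star_mul, star_star]
  · obtain ⟨t, h0, ht⟩ := hτ x
    change 0 ≤ (τ (star (x : A) * x)).re
    rw [ht]; exact h0
  · exact Subtype.ext (hf x hx)

/-- On a finite-dimensional `*`-algebra with a faithful trace `τ` there is a central self-adjoint
element `k` with `τ b = Tr (x ↦ b x k)`, and `k` is not annihilated by nonzero positive
functionals. -/
theorem StarSubalgebra.exists_trace_density (B : StarSubalgebra ℂ A) [FiniteDimensional ℂ B]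
    {τ : A →ₗ[ℂ] ℂ} (hτ : IsTracialState τ) (hf : ∀ a, τ (star a * a) = 0 → a = 0) :
    ∃ k : B, (∀ b : B,
        LinearMap.trace ℂ B (LinearMap.mulLeft ℂ b ∘ₗ LinearMap.mulRight ℂ k) = τ b) ∧
      (∀ b : B, LinearMap.trace ℂ B (LinearMap.mulLeft ℂ k ∘ₗ LinearMap.mulRight ℂ b) = τ b) ∧
      ∀ ψ : A →ₗ[ℂ] ℂ, IsPositiveFunctional ψ → ψ k = 0 → ψ 1 = 0 := by
  obtain ⟨n, e, he⟩ := B.exists_expansion hτ.isPositiveFunctional hf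
  have he' (b : B) : b = ∑ i, τ ((e i : A) * b) • star (e i) := by
    have := congrArg star (he (star b))
    rw [star_star, star_sum] at this
    rw [this]
    refine Finset.sum_congr rfl fun i _ => ?_
    rw [star_smul, ← hτ.isPositiveFunctional.map_star, star_mul, star_star, ← this,
      StarMemClass.coe_star, star_star, hτ.tracial]
  have htr := LinearMap.trace_eq_sum_of_expansion (fun i => B.mulFunctional τ (star (e i : A))) e he
  have htr' := LinearMap.trace_eq_sum_of_expansion (fun i => B.mulFunctional τ (e i : A))
    (fun i => star (e i)) he'
  -- The operator trace of left multiplication by `b` is `τ (b c)`. The density `k` will be the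
  -- inverse of `c`.
  set c : B := ∑ i, e i * star (e i) with hc
  have hcA : (c : A) = ∑ i, (e i : A) * star (e i : A) := by simp [hc]
  have hleft (b : B) : LinearMap.trace ℂ B (LinearMap.mulLeft ℂ b) = τ (b * c) := by
    rw [htr, hcA, Finset.mul_sum, map_sum]
    refine Finset.sum_congr rfl fun i _ => ?_
    simp only [StarSubalgebra.mulFunctional_apply, LinearMap.mulLeft_apply, MulMemClass.coe_mul]
    rw [hτ.tracial, mul_assoc]
  -- Expanding the trace of right multiplication over `e` and that of left multiplication over `e*`
  -- gives the same sum, by traciality.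
  have hright (b : B) : LinearMap.trace ℂ B (LinearMap.mulRight ℂ b) = τ (b * c) := by
    rw [← hleft, htr, htr']
    refine Finset.sum_congr rfl fun i _ => ?_
    simp only [StarSubalgebra.mulFunctional_apply, LinearMap.mulLeft_apply,
      LinearMap.mulRight_apply, MulMemClass.coe_mul, StarMemClass.coe_star]
    rw [← mul_assoc, ← mul_assoc, hτ.tracial, ← mul_assoc, hτ.tracial, ← mul_assoc]
  have hzero (x : B) (h : ∀ a : B, τ (a * x) = 0) : x = 0 :=
    Subtype.ext (hf x (by simpa using h (star x)))
  have hcomm (b : B) : b * c = c * b := by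
    rw [← sub_eq_zero]
    refine hzero _ fun a => ?_
    have h1 : LinearMap.trace ℂ B (LinearMap.mulLeft ℂ (a * b)) =
        LinearMap.trace ℂ B (LinearMap.mulLeft ℂ (b * a)) := by
      rw [LinearMap.mulLeft_mul, LinearMap.mulLeft_mul, LinearMap.trace_comp_comm']
    rw [hleft, hleft] at h1
    push_cast at h1 ⊢
    rw [mul_sub, map_sub, ← mul_assoc, h1, mul_assoc, hτ.tracial, mul_assoc, sub_self]
  have hcs : star c = c := by rw [hc, star_sum]; simp
  -- If `c b = 0`, then `τ (b* c b)` is a vanishing sum of the nonnegative numbers `τ ((e i* b)* (e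
  -- i* b))`; by faithfulness all `e i* b` vanish, and these give the coefficients of `b`.
  have hinj : Function.Injective (LinearMap.mulLeft ℂ c) := by
    rw [injective_iff_map_eq_zero]
    intro b hb
    rw [LinearMap.mulLeft_apply] at hb
    have h1 : ∑ i, τ (star (star (e i : A) * b) * (star (e i : A) * b)) = 0 := by
      have h2 : τ (star (b : A) * ((c * b : B) : A)) = 0 := by rw [hb]; simp
      rw [← h2, MulMemClass.coe_mul, hcA, Finset.sum_mul, Finset.mul_sum, map_sum]
      simp [mul_assoc]
    choose t ht0 ht using fun i => hτ.nonneg (star (e i : A) * b)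
    simp_rw [ht] at h1
    rw [← Complex.ofReal_sum, Complex.ofReal_eq_zero,
      Finset.sum_eq_zero_iff_of_nonneg fun i _ => ht0 i] at h1
    rw [he b]
    refine Finset.sum_eq_zero fun i hi => ?_
    rw [hf (star (e i : A) * b) (by rw [ht, h1 i hi, Complex.ofReal_zero]), map_zero, zero_smul]
  obtain ⟨k, hk⟩ := LinearMap.injective_iff_surjective.1 hinj 1
  rw [LinearMap.mulLeft_apply] at hk
  have hk' : k * c = 1 := by rw [hcomm, hk]
  have hkcomm (b : B) : k * b = b * k := by
    calc k * b = k * b * (c * k) := by rw [hk, mul_one]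
      _ = k * (b * c) * k := by simp only [mul_assoc]
      _ = (k * c) * b * k := by rw [hcomm]; simp only [mul_assoc]
      _ = b * k := by rw [hk', one_mul]
  have hks : star k = k := by
    calc star k = star k * star c * k := by rw [hcs, mul_assoc, hk, mul_one]
      _ = k := by rw [← star_mul, hk, star_one, one_mul]
  have hbk (b : B) : τ ((b * k : B) * c) = τ b := by
    rw [← MulMemClass.coe_mul, mul_assoc, hk', mul_one]
  refine ⟨k, fun b => ?_, fun b => ?_, fun ψ hψ h0 => ?_⟩
  · rw [← hbk, ← hleft]
    congr 1
    ext x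
    simp only [LinearMap.comp_apply, LinearMap.mulLeft_apply, LinearMap.mulRight_apply]
    rw [mul_assoc, hkcomm]
  · rw [← hbk, ← hright]
    congr 1
    ext x
    simp only [LinearMap.comp_apply, LinearMap.mulLeft_apply, LinearMap.mulRight_apply]
    rw [hkcomm, mul_assoc]
  -- Since `k = k c k` is this sum of squares, `ψ k = 0` forces `ψ (e i* k) = 0`, while `1 = c k` is
  -- a combination of the `e i* k`.
  · have hsum : (k : A) = ∑ i, star (star (e i : A) * k) * (star (e i : A) * k) := by
      have : k = k * c * k := by rw [hk', one_mul]
      conv_lhs => rw [this, hc, Finset.mul_sum, Finset.sum_mul]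
      have hks' : star (k : A) = k := congrArg Subtype.val hks
      simp [mul_assoc, hks']
    rw [hsum, map_sum] at h0
    choose t ht0 ht using fun i => hψ (star (e i : A) * k)
    simp_rw [ht] at h0
    rw [← Complex.ofReal_sum, Complex.ofReal_eq_zero,
      Finset.sum_eq_zero_iff_of_nonneg fun i _ => ht0 i] at h0
    have hz (i : Fin n) : ψ (star (e i : A) * k) = 0 := by
      simpa using hψ.map_mul_eq_zero (a := star (e i : A) * k)
        (by rw [ht, h0 i (Finset.mem_univ i), Complex.ofReal_zero]) 1
    have h1 : (1 : A) = ∑ i, τ ((e i : A) * c) • (star (e i : A) * k) := by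
      have : (1 : B) = (∑ i, τ ((e i : A) * c) • star (e i)) * k := by rw [← he', hk]
      have := congrArg Subtype.val this
      rw [Finset.sum_mul] at this
      simpa using this
    rw [h1, map_sum]
    refine Finset.sum_eq_zero fun i _ => ?_
    rw [map_smul, hz, smul_zero]

end Density

/-! ### Gram-Schmidt orthogonalization over a finite-dimensional algebra -/

section GramSchmidt

variable {A : Type u} [CStarAlgebra A]

/-- A positive element of a finite-dimensional commutant has a pseudo-inverse square root there. -/
lemma exists_pseudoinverse_sqrt (B : StarSubalgebra ℂ A) [FiniteDimensional ℂ B] {s : Set A}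
    (hB : B = StarSubalgebra.centralizer ℂ s) {g : A} (hg : g ∈ B) (hpos : ∃ c, g = star c * c) :
    ∃ h ∈ B, star h = h ∧ h * g = g * h ∧ g * (h * h) * g = g := by
  let _ := CStarAlgebra.spectralOrder A
  let _ := CStarAlgebra.spectralOrderedRing A
  have hg0 : 0 ≤ g := by
    obtain ⟨c, rfl⟩ := hpos
    exact star_mul_self_nonneg c
  have hsa : IsSelfAdjoint g := .of_nonneg hg0
  -- An element of a finite-dimensional algebra is a root of a polynomial. With finite spectrum
  -- every function is continuous on it, so even a discontinuous one enters the functional calculus.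
  have hfin : (spectrum ℝ g).Finite := by
    have hint : IsIntegral ℂ (⟨g, hg⟩ : B) := Algebra.IsIntegral.isIntegral _
    obtain ⟨p, hp, hp0⟩ := hint.map B.subtype
    have hp0' : Polynomial.aeval g p = 0 := hp0
    have hC : (spectrum ℂ g).Finite := by
      refine (p.roots.toFinset.finite_toSet).subset fun z hz => ?_
      have h1 := spectrum.subset_polynomial_aeval g p ⟨z, hz, rfl⟩
      rw [hp0'] at h1
      have : p.eval z = 0 := by
        by_contra hne
        refine h1 ?_
        rw [spectrum.mem_resolventSet_iff, sub_zero]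
        exact (IsUnit.mk0 _ hne).map (algebraMap ℂ A)
      simpa [hp.ne_zero] using this
    refine (hC.preimage (Complex.ofReal_injective.injOn)).subset fun t ht => ?_
    exact spectrum.algebraMap_mem ℂ ht
  -- The convention `0⁻¹ = 0` makes this the pseudo-inverse at `t = 0`.
  set f : ℝ → ℝ := fun t => (√t)⁻¹ with hf
  have hcont (u : ℝ → ℝ) : ContinuousOn u (spectrum ℝ g) := hfin.continuousOn u
  have hcom : Commute (cfc f g) g := (Commute.refl g).cfc_real f
  refine ⟨cfc f g, ?_, (cfc_predicate f g : IsSelfAdjoint _), hcom.eq, ?_⟩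
  · rw [hB, StarSubalgebra.mem_centralizer_iff] at hg ⊢
    intro b hb
    obtain ⟨h1, h2⟩ := hg b hb
    exact ⟨((show Commute g b from h1.symm).cfc_real f).eq.symm,
      ((show Commute g (star b) from h2.symm).cfc_real f).eq.symm⟩
  · have hid : cfc (fun t : ℝ => t) g = g := cfc_id' ℝ g
    have hmul : cfc (fun t : ℝ => t * (f t * f t) * t) g = g * (cfc f g * cfc f g) * g := by
      rw [cfc_mul (fun t : ℝ => t * (f t * f t)) (fun t => t) g (hcont _) (hcont _),
        cfc_mul (fun t : ℝ => t) (fun t => f t * f t) g (hcont _) (hcont _),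
        cfc_mul f f g (hcont _) (hcont _), hid]
    rw [← hmul]
    conv_rhs => rw [← hid]
    refine cfc_congr fun t ht => ?_
    have ht0 : 0 ≤ t := spectrum_nonneg_of_nonneg hg0 ht
    rcases ht0.eq_or_lt with rfl | h
    · simp
    · simp only [hf]
      have := Real.mul_self_sqrt ht0
      have h0 : √t ≠ 0 := by positivity
      field_simp
      nlinarith

namespace Correspondence

variable (Y : Correspondence A)

lemma ketBra_snoc {n : ℕ} (y : Fin n → Y) (u z : Y) :
    Y.ketBra (Fin.snoc y u : Fin (n + 1) → Y) (Fin.snoc y u : Fin (n + 1) → Y) z =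
      Y.ketBra y y z + op (Y.inner u z) • u := by
  simp [ketBra_apply, Fin.sum_univ_castSucc]

lemma ketBra_mem_of_ketBra_self {n : ℕ} {y : Fin n → Y} (h : ∀ j, Y.ketBra y y (y j) = y j)
    (z : Y) : Y.ketBra y y (Y.ketBra y y z) = Y.ketBra y y z := by
  conv_lhs => rw [Y.ketBra_apply y y z]
  rw [map_sum]
  simp_rw [ketBra_op_smul, h]
  rw [ketBra_apply]

/-- Gram-Schmidt orthogonalization: the right `A`-span of a finite family with Gram matrix in the
finite-dimensional algebra `B` has a projective basis in the right `B`-module generated by the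
family. -/
theorem exists_gramSchmidt (B : StarSubalgebra ℂ A) [FiniteDimensional ℂ B] {s : Set A}
    (hB : B = StarSubalgebra.centralizer ℂ s) (W : AddSubgroup Y)
    (hWB : ∀ w ∈ W, ∀ b ∈ B, op b • w ∈ W) (hWW : ∀ w ∈ W, ∀ w' ∈ W, Y.inner w w' ∈ B)
    {n : ℕ} (w : Fin n → Y) (hw : ∀ i, w i ∈ W) :
    ∃ (m : ℕ) (y : Fin m → Y), (∀ j, y j ∈ W) ∧ (∀ j, Y.ketBra y y (y j) = y j) ∧
      ∀ i, Y.ketBra y y (w i) = w i := by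
  induction n with
  | zero => exact ⟨0, Fin.elim0, fun j => j.elim0, fun j => j.elim0, fun i => i.elim0⟩
  | succ n ih =>
    obtain ⟨m, y, hyW, hyy, hyw⟩ := ih (fun i => w i.castSucc) fun i => hw _
    set v := w (Fin.last n) - Y.ketBra y y (w (Fin.last n)) with hv
    have hvW : v ∈ W := by
      refine W.sub_mem (hw _) ?_
      rw [ketBra_apply]
      exact W.sum_mem fun j _ => hWB _ (hyW j) _ (hWW _ (hyW j) _ (hw _))
    have hyv : Y.ketBra y y v = 0 := by
      rw [hv, map_sub, ketBra_mem_of_ketBra_self Y hyy, sub_self]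
    have hortho (z : Y) (hz : Y.ketBra y y z = z) : Y.inner v z = 0 := by
      rw [← hz, ← inner_ketBra_self, hyv, inner_zero_left]
    obtain ⟨h, hhB, hhs, hcom, hgh⟩ := exists_pseudoinverse_sqrt B hB (hWW v hvW v hvW)
      (Y.inner_self_nonneg v)
    set g := Y.inner v v with hg
    have hgs : star g = g := Y.star_inner v v
    -- `h² g` acts as the support projection of `g = ⟨v | v⟩`: the difference of the two sides has
    -- inner square zero because `g h² g = g`.
    have hvhg : op (h * h * g) • v = v := by
      rw [← sub_eq_zero]
      apply eq_zero_of_inner_self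
      have h2 : star (h * h * g) * g = g := by
        rw [star_mul, star_mul, hgs, hhs, hgh]
      simp only [inner_sub_left, inner_sub_right, Y.inner_op_smul_right, inner_op_smul_left, ← hg]
      rw [h2]
      simp
    set u := op h • v with hu
    have huz (z : Y) : Y.inner u z = h * Y.inner v z := by rw [hu, inner_op_smul_left, hhs]
    have huu : op (Y.inner u u) • u = u := by
      rw [huz, hu, Y.inner_op_smul_right, op_smul_op_smul, ← hg]
      have : h * (h * (g * h)) = h * h * g * h := by simp only [mul_assoc]
      rw [this, ← op_smul_op_smul, hvhg]
    have hyu : Y.ketBra y y u = 0 := by rw [hu, ketBra_op_smul, hyv, smul_zero]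
    refine ⟨m + 1, Fin.snoc y u, fun j => ?_, fun j => ?_, fun i => ?_⟩
    · refine Fin.lastCases ?_ (fun j => ?_) j
      · rw [Fin.snoc_last]; exact hWB v hvW h hhB
      · rw [Fin.snoc_castSucc]; exact hyW j
    · rw [ketBra_snoc]
      refine Fin.lastCases ?_ (fun j => ?_) j
      · rw [Fin.snoc_last, hyu, huu, zero_add]
      · rw [Fin.snoc_castSucc, hyy, huz, hortho _ (hyy j), mul_zero, op_zero, zero_smul, add_zero]
    · rw [ketBra_snoc]
      refine Fin.lastCases ?_ (fun i => ?_) i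
      · have : Y.inner v (w (Fin.last n)) = g := by
          rw [hg]
          conv_rhs => rw [hv]
          rw [inner_sub_right, hortho _ (ketBra_mem_of_ketBra_self Y hyy _), sub_zero]
        rw [huz, this, hu, op_smul_op_smul, ← mul_assoc, hvhg, hv, add_sub_cancel]
      · rw [hyw, huz, hortho _ (hyw i), mul_zero, op_zero, zero_smul, add_zero]

end Correspondence

end GramSchmidt

namespace Correspondence

variable {A : Type u} [CStarAlgebra A]

/-! ### The trace of a family of vectors -/

section BasisTrace

variable {X : Correspondence A}

/-- The functional `a ↦ ∑ i, τ ⟨x i | a x i⟩`. -/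
noncomputable def basisTrace (τ : A →ₗ[ℂ] ℂ) {n : ℕ} (x : Fin n → X) : A →ₗ[ℂ] ℂ where
  toFun a := ∑ i, τ (X.inner (x i) (a • x i))
  map_add' a b := by simp_rw [add_smul, X.inner_add_right, map_add, Finset.sum_add_distrib]
  map_smul' c a := by
    simp_rw [smul_assoc, inner_smul_right, map_smul, RingHom.id_apply, Finset.smul_sum]

lemma basisTrace_apply (τ : A →ₗ[ℂ] ℂ) {n : ℕ} (x : Fin n → X) (a : A) :
    basisTrace τ x a = ∑ i, τ (X.inner (x i) (a • x i)) := rfl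

lemma exists_map_inner_self {τ : A →ₗ[ℂ] ℂ} (hτ : IsPositiveFunctional τ) (x : X) :
    ∃ t : ℝ, 0 ≤ t ∧ τ (X.inner x x) = t := by
  obtain ⟨c, hc⟩ := X.inner_self_nonneg x
  rw [hc]
  exact hτ c

lemma isPositiveFunctional_basisTrace {τ : A →ₗ[ℂ] ℂ} (hτ : IsPositiveFunctional τ) {n : ℕ}
    (x : Fin n → X) : IsPositiveFunctional (basisTrace τ x) := by
  intro a
  choose t h0 ht using fun i => exists_map_inner_self hτ (a • x i)
  refine ⟨∑ i, t i, Finset.sum_nonneg fun i _ => h0 i, ?_⟩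
  rw [basisTrace_apply, Complex.ofReal_sum]
  refine Finset.sum_congr rfl fun i _ => ?_
  rw [← ht, X.inner_smul_left, mul_smul]

lemma IsProjectiveBasis.inner_eq_sum {n : ℕ} {x : Fin n → X} (hx : X.IsProjectiveBasis x)
    (v w : X) : X.inner v w = ∑ i, X.inner v (x i) * X.inner (x i) w := by
  conv_lhs => rw [hx w, inner_sum_right]
  simp_rw [X.inner_op_smul_right]

/-- Inserting the other basis in the middle turns both sides into double sums that agree by
traciality of `τ`. With `x = y` this is traciality, with `b = 1` independence of the basis. -/
lemma basisTrace_mul_comm {τ : A →ₗ[ℂ] ℂ} (hτ : IsTracialState τ) {m n : ℕ} {x : Fin m → X}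
    {y : Fin n → X} (hx : X.IsProjectiveBasis x) (hy : X.IsProjectiveBasis y) (a b : A) :
    basisTrace τ x (a * b) = basisTrace τ y (b * a) := by
  have hl (i : Fin m) : τ (X.inner (x i) ((a * b) • x i)) =
      ∑ j, τ (X.inner (x i) (a • y j) * X.inner (y j) (b • x i)) := by
    rw [mul_smul, inner_smul_right_eq, hy.inner_eq_sum, map_sum]
    simp_rw [inner_smul_right_eq]
  have hr (j : Fin n) : τ (X.inner (y j) ((b * a) • y j)) =
      ∑ i, τ (X.inner (y j) (b • x i) * X.inner (x i) (a • y j)) := by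
    rw [mul_smul, inner_smul_right_eq, hx.inner_eq_sum, map_sum]
    simp_rw [inner_smul_right_eq]
  rw [basisTrace_apply, basisTrace_apply]
  simp_rw [hl, hr]
  rw [Finset.sum_comm]
  simp_rw [hτ.tracial]

lemma basisTrace_eq_basisTrace {τ : A →ₗ[ℂ] ℂ} (hτ : IsTracialState τ) {m n : ℕ} {x : Fin m → X}
    {y : Fin n → X} (hx : X.IsProjectiveBasis x) (hy : X.IsProjectiveBasis y) :
    basisTrace τ x = basisTrace τ y := by
  ext a
  simpa using basisTrace_mul_comm hτ hx hy a 1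

/-- The functional is positive and tracial. Adding `τ` before normalizing avoids division by zero
when its value at `1` is zero. -/
lemma exists_basisTrace_eq_smul {τ : A →ₗ[ℂ] ℂ} (hτ : IsTracialState τ)
    (huniq : ∀ τ', IsTracialState τ' → τ' = τ) {n : ℕ} {x : Fin n → X}
    (hx : X.IsProjectiveBasis x) : ∃ d : ℂ, basisTrace τ x = d • τ := by
  have hpos := isPositiveFunctional_basisTrace hτ.isPositiveFunctional x
  obtain ⟨d, hd0, hd⟩ := hpos 1
  rw [star_one, mul_one] at hd
  have hne : ((d + 1 : ℝ) : ℂ) ≠ 0 := Complex.ofReal_ne_zero.2 (by positivity)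
  have key : ((d + 1 : ℝ) : ℂ)⁻¹ • (basisTrace τ x + τ) = τ := by
    refine huniq _ ⟨?_, fun a => ?_, fun a b => ?_⟩
    · rw [LinearMap.smul_apply, LinearMap.add_apply, hd, hτ.map_one, smul_eq_mul]
      push_cast at hne ⊢
      exact inv_mul_cancel₀ hne
    · obtain ⟨t, ht0, ht⟩ := hpos a
      obtain ⟨t', ht0', ht'⟩ := hτ.nonneg a
      refine ⟨(d + 1)⁻¹ * (t + t'), by positivity, ?_⟩
      rw [LinearMap.smul_apply, LinearMap.add_apply, ht, ht', smul_eq_mul]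
      push_cast
      rfl
    · rw [LinearMap.smul_apply, LinearMap.smul_apply, LinearMap.add_apply, LinearMap.add_apply,
        basisTrace_mul_comm hτ hx hx, hτ.tracial]
  refine ⟨d, ?_⟩
  have h1 : basisTrace τ x + τ = ((d + 1 : ℝ) : ℂ) • τ := by
    rw [← key, smul_smul, mul_inv_cancel₀ hne, one_smul, key]
  rw [← add_left_inj τ, h1]
  push_cast
  rw [add_smul, one_smul]

/-- The complement of the projection `p` onto the span of `y` carries the missing trace. Its form as
a sum of inner squares `⟨(1 - p) w | (1 - p) w⟩` shows that the difference is a positive functional.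
-/
lemma basisTrace_sub_basisTrace {τ : A →ₗ[ℂ] ℂ} (hτ : IsTracialState τ) {m n : ℕ} {z : Fin m → X}
    {y : Fin n → X} (hz : X.IsProjectiveBasis z) (hy : ∀ j, X.ketBra y y (y j) = y j) (a : A) :
    basisTrace τ z (star a * a) - basisTrace τ y (star a * a) =
      ∑ k, τ (X.inner (star a • z k - X.ketBra y y (star a • z k))
        (star a • z k - X.ketBra y y (star a • z k))) := by
  have h1 (w : X) : X.inner (w - X.ketBra y y w) (w - X.ketBra y y w) =
      X.inner w w - ∑ j, X.inner w (y j) * X.inner (y j) w := by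
    have h2 : X.inner (X.ketBra y y w) (w - X.ketBra y y w) = 0 := by
      rw [inner_ketBra_self, map_sub, ketBra_mem_of_ketBra_self X hy, sub_self, inner_zero_right]
    rw [inner_sub_left, h2, sub_zero, inner_sub_right]
    conv_lhs => rw [ketBra_apply, inner_sum_right]
    simp_rw [X.inner_op_smul_right]
  rw [basisTrace_mul_comm hτ hz hz]
  simp_rw [h1, map_sub, map_sum]
  rw [Finset.sum_sub_distrib, basisTrace_apply, basisTrace_apply]
  congr 1
  · refine Finset.sum_congr rfl fun k _ => ?_
    rw [X.inner_smul_left, star_star, mul_smul]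
  · rw [Finset.sum_comm]
    refine Finset.sum_congr rfl fun j _ => ?_
    have : X.inner (y j) ((star a * a) • y j) = X.inner (a • y j) (a • y j) := by
      rw [X.inner_smul_left, mul_smul]
    rw [this, hz.inner_eq_sum, map_sum]
    refine Finset.sum_congr rfl fun k _ => ?_
    rw [hτ.tracial, X.inner_smul_left a, X.inner_smul_left (star a), star_star]

/-- An orthogonal family whose trace agrees with that of a projective basis is a projective
basis. -/
lemma isProjectiveBasis_of_basisTrace_one {τ : A →ₗ[ℂ] ℂ} (hτ : IsTracialState τ)
    (hf : ∀ a, τ (star a * a) = 0 → a = 0) {m n : ℕ} {z : Fin m → X}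
    {y : Fin n → X} (hz : X.IsProjectiveBasis z) (hy : ∀ j, X.ketBra y y (y j) = y j)
    (h1 : (basisTrace τ z - basisTrace τ y) 1 = 0) : X.IsProjectiveBasis y := by
  have h2 := basisTrace_sub_basisTrace hτ hz hy 1
  rw [star_one, mul_one, ← LinearMap.sub_apply, h1] at h2
  choose t ht0 ht using fun k => exists_map_inner_self hτ.isPositiveFunctional
    ((1 : A) • z k - X.ketBra y y ((1 : A) • z k))
  simp_rw [ht] at h2
  rw [eq_comm, ← Complex.ofReal_sum, Complex.ofReal_eq_zero,
    Finset.sum_eq_zero_iff_of_nonneg fun i _ => ht0 i] at h2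
  have hzk (k : Fin m) : X.ketBra y y (z k) = z k := by
    have h3 := ht k
    rw [h2 k (Finset.mem_univ k), Complex.ofReal_zero, one_smul] at h3
    obtain ⟨c, hc⟩ := X.inner_self_nonneg (z k - X.ketBra y y (z k))
    have h4 : X.inner (z k - X.ketBra y y (z k)) (z k - X.ketBra y y (z k)) = 0 := by
      rw [hc] at h3 ⊢
      rw [hf c h3, mul_zero]
    exact (sub_eq_zero.1 (eq_zero_of_inner_self h4)).symm
  rw [isProjectiveBasis_iff]
  intro v
  conv_lhs => rw [hz v]
  rw [map_sum]
  simp_rw [ketBra_op_smul, hzk]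
  exact (hz v).symm

end BasisTrace

/-! ### Two trace formulas on a finite-dimensional sub-bimodule -/

section SubBimodule

variable {X Y : Correspondence A} (B : StarSubalgebra ℂ A) (V : Submodule ℂ X)

/-- `V` is a sub-bimodule over `B` with `B`-valued inner products. -/
structure IsSubBimodule : Prop where
  smul_mem : ∀ b ∈ B, ∀ v ∈ V, b • v ∈ V
  op_smul_mem : ∀ b ∈ B, ∀ v ∈ V, op b • v ∈ V
  inner_mem : ∀ v ∈ V, ∀ w ∈ V, X.inner v w ∈ B

variable {B V}

/-- The operator `v ↦ b v d` on a sub-bimodule. -/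
def IsSubBimodule.bimul (hV : IsSubBimodule B V) (b d : B) : V →ₗ[ℂ] V :=
  (X.leftMul b ∘ₗ X.rightAct d).restrict fun v hv =>
    hV.smul_mem b b.2 _ (hV.op_smul_mem d d.2 v hv)

/-- The basis factors `v ↦ b v k` as a sum of maps `V → B → V`. Cyclicity moves the trace to `B`,
where the `i`-th term is `β ↦ ⟨x i | b x i⟩ β k`, of trace `τ ⟨x i | b x i⟩`. -/
lemma IsSubBimodule.trace_bimul_right (hV : IsSubBimodule B V) [FiniteDimensional ℂ B]
    [FiniteDimensional ℂ V] {τ : A →ₗ[ℂ] ℂ} {k : B}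
    (hk : ∀ b : B,
      LinearMap.trace ℂ B (LinearMap.mulLeft ℂ b ∘ₗ LinearMap.mulRight ℂ k) = τ b)
    {n : ℕ} {x : Fin n → X} (hxV : ∀ i, x i ∈ V) (hx : ∀ v ∈ V, X.ketBra x x v = v) (b : B) :
    LinearMap.trace ℂ V (hV.bimul b k) = basisTrace τ x b := by
  let f (i : Fin n) : V →ₗ[ℂ] B :=
    { toFun := fun v => ⟨X.inner (x i) ((b : A) • (v : X)) * k,
        B.mul_mem (hV.inner_mem _ (hxV i) _ (hV.smul_mem _ b.2 _ v.2)) k.2⟩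
      map_add' := fun v w => Subtype.ext (by
        simp [smul_add, X.inner_add_right, add_mul])
      map_smul' := fun c v => Subtype.ext (by
        change X.inner (x i) (X.leftMul b (c • (v : X))) * k = c • (_ * _)
        rw [map_smul, inner_smul_right, smul_mul_assoc]; rfl) }
  let g (i : Fin n) : B →ₗ[ℂ] V :=
    ((X.rightMul (x i)).toLinearMap ∘ₗ B.subtype.toLinearMap).codRestrict V
      fun β => hV.op_smul_mem _ β.2 _ (hxV i)
  have hT : hV.bimul b k = ∑ i, g i ∘ₗ f i := by
    ext v
    rw [LinearMap.sum_apply, AddSubmonoidClass.coe_finsetSum]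
    change (b : A) • op (k : A) • (v : X) = ∑ i, op (X.inner (x i) ((b : A) • (v : X)) * k) • x i
    rw [smul_op_smul, ← hx _ (hV.smul_mem _ b.2 _ v.2), ketBra_apply, Finset.smul_sum]
    simp_rw [op_smul_op_smul, ← ketBra_apply]
    rw [hx _ (hV.smul_mem _ b.2 _ v.2)]
  rw [hT, map_sum, basisTrace_apply]
  refine Finset.sum_congr rfl fun i _ => ?_
  rw [LinearMap.trace_comp_comm',
    ← hk ⟨X.inner (x i) ((b : A) • x i), hV.inner_mem _ (hxV i) _ (hV.smul_mem _ b.2 _ (hxV i))⟩]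
  congr 1
  ext β
  change X.inner (x i) ((b : A) • op (β : A) • x i) * k = X.inner (x i) ((b : A) • x i) * (β * k)
  rw [smul_op_smul, X.inner_op_smul_right, mul_assoc]

/-- The mirror image: a right expansion of `J v` is, through `J`, a left expansion of `v`. The maps
on `B` become `β ↦ k β ⟨J x i | b J x i⟩`. -/
lemma IsSubBimodule.trace_bimul_left (hV : IsSubBimodule B V) [FiniteDimensional ℂ B]
    [FiniteDimensional ℂ V] (J : Conjugation X Y)
    (hJ : ∀ v ∈ V, ∀ w ∈ V, Y.inner (J v) (J w) ∈ B) {τ : A →ₗ[ℂ] ℂ} {k : B}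
    (hk : ∀ b : B,
      LinearMap.trace ℂ B (LinearMap.mulLeft ℂ k ∘ₗ LinearMap.mulRight ℂ b) = τ b)
    {n : ℕ} {x : Fin n → X} (hxV : ∀ i, x i ∈ V)
    (hx : ∀ v ∈ V, Y.ketBra (fun i => J (x i)) (fun i => J (x i)) (J v) = J v) (b : B) :
    LinearMap.trace ℂ V (hV.bimul k b) = basisTrace τ (fun i => J (x i)) b := by
  let f (i : Fin n) : V →ₗ[ℂ] B :=
    { toFun := fun v => ⟨k * Y.inner (J v) (J (x i)), B.mul_mem k.2 (hJ _ v.2 _ (hxV i))⟩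
      map_add' := fun v w => Subtype.ext (by
        simp [map_add, inner_add_left, mul_add])
      map_smul' := fun c v => Subtype.ext (by
        change (k : A) * Y.inner (J (c • (v : X))) (J (x i)) = c • (_ * _)
        rw [complex_smul_eq_left, J.map_smul_left, inner_op_smul_left, star_star, smul_mul_assoc,
          one_mul, mul_smul_comm]) }
  let g (i : Fin n) : B →ₗ[ℂ] V :=
    { toFun := fun β => ⟨(β : A) • op (b : A) • x i,
        hV.smul_mem _ β.2 _ (hV.op_smul_mem _ b.2 _ (hxV i))⟩
      map_add' := fun β γ => Subtype.ext (by simp [add_smul])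
      map_smul' := fun c β => Subtype.ext (by simp [smul_assoc]) }
  have hexp (v : X) (hv : v ∈ V) : ∑ i, Y.inner (J v) (J (x i)) • x i = v := by
    apply J.injective
    change J _ = J v
    conv_rhs => rw [← hx v hv, ketBra_apply]
    rw [map_sum]
    simp_rw [J.map_smul_left, Y.star_inner]
  have hT : hV.bimul k b = ∑ i, g i ∘ₗ f i := by
    ext v
    rw [LinearMap.sum_apply, AddSubmonoidClass.coe_finsetSum]
    change (k : A) • op (b : A) • (v : X) =
      ∑ i, ((k : A) * Y.inner (J v) (J (x i))) • op (b : A) • x i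
    conv_lhs => rw [← hexp v v.2, Finset.smul_sum, Finset.smul_sum]
    simp_rw [mul_smul, smul_op_smul]
  rw [hT, map_sum, basisTrace_apply]
  refine Finset.sum_congr rfl fun i _ => ?_
  have hmem : Y.inner (J (x i)) ((b : A) • J (x i)) ∈ B := by
    rw [inner_smul_right_eq, ← J.map_op_smul]
    exact hJ _ (hV.op_smul_mem _ b.2 _ (hxV i)) _ (hxV i)
  rw [LinearMap.trace_comp_comm', ← hk ⟨_, hmem⟩]
  congr 1
  ext β
  change (k : A) * Y.inner (J ((β : A) • op (b : A) • x i)) (J (x i)) =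
    k * (β * Y.inner (J (x i)) ((b : A) • J (x i)))
  rw [J.map_smul_left, J.map_op_smul, inner_op_smul_left, star_star, Y.inner_smul_left, star_star]

end SubBimodule

end Correspondence

namespace SpinChain

open Correspondence

variable {A : Type u} [CStarAlgebra A] (S : SpinChain A)

/-! ### Local algebras and commutants -/

section Commutant

lemma alg_mono {F G : Set ℤ} (h : F ⊆ G) : S.alg F ≤ S.alg G :=
  StarSubalgebra.topologicalClosure_mono
    (iSup_le fun I => le_iSup (fun I : {I : NonemptyInterval ℤ // (I : Set ℤ) ⊆ G} => S.loc I)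
      ⟨I.1, I.2.trans h⟩)

lemma alg_coe_le (J : NonemptyInterval ℤ) : S.alg (J : Set ℤ) ≤ S.loc J := by
  have := S.finiteDimensional J
  refine StarSubalgebra.topologicalClosure_minimal ?_ ?_
  · exact iSup_le fun I => S.mono _ _ (NonemptyInterval.coe_subset_coe.1 I.2)
  · exact Submodule.closed_of_finiteDimensional (S.loc J).toSubalgebra.toSubmodule

lemma alg_compl_commute {J : NonemptyInterval ℤ} {F : Set ℤ} (hJ : (J : Set ℤ) ⊆ F) {a b : A}
    (ha : a ∈ S.loc J) (hb : b ∈ S.alg Fᶜ) : b * a = a * b := by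
  have hle : S.alg Fᶜ ≤ StarSubalgebra.centralizer ℂ (S.loc J : Set A) := by
    refine StarSubalgebra.topologicalClosure_minimal ?_ ?_
    · refine iSup_le fun I c hc => ?_
      rw [StarSubalgebra.mem_centralizer_iff]
      have hd : Disjoint (J : Set ℤ) (I.1 : Set ℤ) :=
        Set.disjoint_of_subset hJ I.2 disjoint_compl_right
      exact fun g hg => ⟨S.commute _ _ hd g hg c hc, S.commute _ _ hd _ (star_mem hg) c hc⟩
    · exact Set.isClosed_centralizer _
  exact ((StarSubalgebra.mem_centralizer_iff ℂ).1 (hle hb) a ha).1.symm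

/-- The commutant in `A` of `A_{F^c}`. -/
noncomputable def commutant (F : Set ℤ) : StarSubalgebra ℂ A :=
  StarSubalgebra.centralizer ℂ (S.alg Fᶜ : Set A)

lemma mem_commutant {F : Set ℤ} {a : A} :
    a ∈ S.commutant F ↔ ∀ b ∈ S.alg Fᶜ, b * a = a * b := by
  rw [commutant, StarSubalgebra.mem_centralizer_iff]
  exact ⟨fun h b hb => (h b hb).1, fun h b hb => ⟨h b hb, h _ (star_mem hb)⟩⟩

/-- Haag duality places the commutant inside the local algebra of the interval `I` enlarged by `R`
on both sides. -/
lemma finiteDimensional_commutant {K R : ℕ} (hHaag : S.WeakHaagDuality K R)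
    {I : NonemptyInterval ℤ} (hI : (K : ℤ) ≤ numSites I) :
    FiniteDimensional ℂ (S.commutant (I : Set ℤ)) := by
  let J : NonemptyInterval ℤ := ⟨⟨I.fst - R, I.snd + R⟩, by
    have := I.fst_le_snd
    change I.fst - R ≤ I.snd + R
    lia⟩
  have hJ : nbhd R (I : Set ℤ) ⊆ (J : Set ℤ) := by
    rintro z ⟨y, hy, hzy⟩
    have hy' : I.fst ≤ y ∧ y ≤ I.snd := hy
    rw [abs_le] at hzy
    change I.fst - R ≤ z ∧ z ≤ I.snd + R
    lia
  have hle : S.commutant (I : Set ℤ) ≤ S.loc J := fun a ha =>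
    S.alg_coe_le J (S.alg_mono hJ (hHaag I hI a (S.mem_commutant.1 ha)))
  have := S.finiteDimensional J
  exact Submodule.finiteDimensional_of_le (S₁ := (S.commutant (I : Set ℤ)).toSubalgebra.toSubmodule)
    (S₂ := (S.loc J).toSubalgebra.toSubmodule) hle

end Commutant

/-! ### Localized vectors -/

section Localized

variable {X Y : Correspondence A}

variable {S} in
lemma Localized.mono {F G : Set ℤ} (h : F ⊆ G) {ξ : X} (hξ : S.Localized X F ξ) :
    S.Localized X G ξ :=
  fun a ha => hξ a (S.alg_mono (Set.compl_subset_compl.2 h) ha)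

variable (X) in
/-- The space of vectors localized in `F`. -/
def localizedVectors (F : Set ℤ) : Submodule ℂ X where
  carrier := {ξ | S.Localized X F ξ}
  add_mem' hξ hη a ha := by rw [smul_add, smul_add, hξ a ha, hη a ha]
  zero_mem' a _ := by rw [smul_zero, smul_zero]
  smul_mem' c ξ hξ a ha := by
    change X.leftMul a (c • ξ) = X.rightAct a (c • ξ)
    rw [map_smul, map_smul]
    exact congrArg (c • ·) (hξ a ha)

variable {S} in
lemma Localized.op_smul {F : Set ℤ} {ξ : X} (hξ : S.Localized X F ξ) {b : A}
    (hb : ∀ a ∈ S.alg Fᶜ, a * b = b * a) : S.Localized X F (op b • ξ) := fun a ha => by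
  rw [smul_op_smul, hξ a ha, op_smul_op_smul, op_smul_op_smul, hb a ha]

variable {S} in
lemma Localized.smul {F : Set ℤ} {ξ : X} (hξ : S.Localized X F ξ) {b : A}
    (hb : ∀ a ∈ S.alg Fᶜ, a * b = b * a) : S.Localized X F (b • ξ) := fun a ha => by
  rw [smul_smul, hb a ha, mul_smul, hξ a ha, smul_op_smul]

variable {S} in
lemma Localized.inner_mem {F : Set ℤ} {ξ η : X} (hξ : S.Localized X F ξ)
    (hη : S.Localized X F η) : X.inner ξ η ∈ S.commutant F := by
  rw [mem_commutant]
  intro a ha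
  rw [← X.inner_op_smul_right, ← hη a ha, inner_smul_right_eq, hξ _ (star_mem ha),
    inner_op_smul_left, star_star]

variable {S} in
-- The condition `a ξ = ξ a` is symmetric under exchange of the two actions.
lemma Localized.conjugation {F : Set ℤ} {ξ : X} (hξ : S.Localized X F ξ) (J : Conjugation X Y) :
    S.Localized Y F (J ξ) := fun a ha => by
  have h1 := congrArg J (hξ _ (star_mem ha))
  rw [J.map_smul_left, J.map_op_smul, star_star] at h1
  exact h1.symm

lemma isSubBimodule_localizedVectors (F : Set ℤ) :
    IsSubBimodule (S.commutant F) (S.localizedVectors X F) where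
  smul_mem _ hb _ hv := Localized.smul hv (S.mem_commutant.1 hb)
  op_smul_mem _ hb _ hv := Localized.op_smul hv (S.mem_commutant.1 hb)
  inner_mem _ hv _ hw := Localized.inner_mem hv hw

/-- Coefficients of a localized vector in a localized basis lie in the commutant. -/
lemma finiteDimensional_localizedVectors {F : Set ℤ} [FiniteDimensional ℂ (S.commutant F)]
    {n : ℕ} {ξ : Fin n → X} (hξ : X.IsProjectiveBasis ξ) (hloc : ∀ i, S.Localized X F (ξ i)) :
    FiniteDimensional ℂ (S.localizedVectors X F) := by
  let f : (Fin n → S.commutant F) →ₗ[ℂ] X :=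
    ∑ i, (X.rightMul (ξ i)).toLinearMap ∘ₗ (S.commutant F).subtype.toLinearMap ∘ₗ
      LinearMap.proj i
  refine Submodule.finiteDimensional_of_le (S₂ := LinearMap.range f) fun v hv => ?_
  refine ⟨fun i => ⟨X.inner (ξ i) v, Localized.inner_mem (hloc i) hv⟩, ?_⟩
  conv_rhs => rw [hξ v]
  rw [LinearMap.sum_apply]
  rfl

/-- The interval `[-n, n]`. -/
def symmInterval (n : ℕ) : NonemptyInterval ℤ :=
  ⟨⟨-n, n⟩, by change -(n : ℤ) ≤ n; lia⟩

lemma symmInterval_mono {m n : ℕ} (h : m ≤ n) :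
    (symmInterval m : Set ℤ) ⊆ (symmInterval n : Set ℤ) := by
  intro z hz
  have hz' : -(m : ℤ) ≤ z ∧ z ≤ m := hz
  change -(n : ℤ) ≤ z ∧ z ≤ n
  lia

lemma exists_subset_symmInterval (I : NonemptyInterval ℤ) :
    ∃ n : ℕ, (I : Set ℤ) ⊆ (symmInterval n : Set ℤ) := by
  refine ⟨I.fst.natAbs + I.snd.natAbs, fun z hz => ?_⟩
  have hz' : I.fst ≤ z ∧ z ≤ I.snd := hz
  change -((I.fst.natAbs + I.snd.natAbs : ℕ) : ℤ) ≤ z ∧ z ≤ ((I.fst.natAbs + I.snd.natAbs : ℕ) : ℤ)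
  lia

variable (X) in
/-- The space of vectors localized in some bounded interval. -/
def boundedVectors : Submodule ℂ X where
  carrier := {ξ | ∃ n : ℕ, S.Localized X (symmInterval n : Set ℤ) ξ}
  add_mem' := by
    rintro ξ η ⟨m, hm⟩ ⟨n, hn⟩
    exact ⟨max m n, (S.localizedVectors X _).add_mem
      (Localized.mono (symmInterval_mono (le_max_left m n)) hm)
      (Localized.mono (symmInterval_mono (le_max_right m n)) hn)⟩
  zero_mem' := ⟨0, (S.localizedVectors X _).zero_mem⟩
  smul_mem' := by
    rintro c ξ ⟨m, hm⟩
    exact ⟨m, (S.localizedVectors X _).smul_mem c hm⟩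

/-- Approximate the coefficients in a localized basis by local elements of `A`. -/
lemma dense_boundedVectors {I : NonemptyInterval ℤ} {n : ℕ} {ξ : Fin n → X}
    (hξ : X.IsProjectiveBasis ξ) (hloc : ∀ i, S.Localized X (I : Set ℤ) (ξ i)) :
    Dense (S.boundedVectors X : Set X) := by
  intro x
  rw [← Submodule.topologicalClosure_coe, hξ x]
  refine Submodule.sum_mem _ fun i _ => ?_
  have ha := S.dense (X.inner (ξ i) x)
  refine map_mem_closure (f := X.rightMul (ξ i)) (X.rightMul (ξ i)).continuous ha fun a ha => ?_
  obtain ⟨J, haJ⟩ := Set.mem_iUnion.1 ha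
  obtain ⟨m, hm⟩ := exists_subset_symmInterval I
  obtain ⟨m', hm'⟩ := exists_subset_symmInterval J
  refine ⟨max m m', Localized.op_smul (Localized.mono ?_ (hloc i)) fun b hb => ?_⟩
  · exact hm.trans (symmInterval_mono (le_max_left m m'))
  · exact S.alg_compl_commute (hm'.trans (symmInterval_mono (le_max_right m m'))) haJ hb

end Localized

/-! ### Localized bases of the conjugate -/

section Conjugate

variable {X Y : Correspondence A}

/-- In every large interval the conjugates of localized vectors generate a direct summand of the
conjugate, whose trace agrees with that of `X` at a strictly positive element. -/
theorem exists_localized_family {K R : ℕ} (hHaag : S.WeakHaagDuality K R) {τ : A →ₗ[ℂ] ℂ}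
    (hτ : IsTracialState τ) (hf : ∀ a, τ (star a * a) = 0 → a = 0) (J : Conjugation X Y)
    {I : NonemptyInterval ℤ} (hI : (K : ℤ) ≤ numSites I) {n : ℕ} {ξ : Fin n → X}
    (hξ : X.IsProjectiveBasis ξ) (hloc : ∀ i, S.Localized X (I : Set ℤ) (ξ i)) :
    ∃ (k : A) (m : ℕ) (y : Fin m → Y),
      (∀ ψ : A →ₗ[ℂ] ℂ, IsPositiveFunctional ψ → ψ k = 0 → ψ 1 = 0) ∧
      (∀ j, S.Localized Y (I : Set ℤ) (y j)) ∧ (∀ j, Y.ketBra y y (y j) = y j) ∧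
      (∀ v, S.Localized X (I : Set ℤ) v → Y.ketBra y y (J v) = J v) ∧
      basisTrace τ y k = basisTrace τ ξ k := by
  set B := S.commutant (I : Set ℤ) with hB
  set V := S.localizedVectors X (I : Set ℤ) with hV
  have hBfin : FiniteDimensional ℂ B := S.finiteDimensional_commutant hHaag hI
  have hVfin : FiniteDimensional ℂ V := S.finiteDimensional_localizedVectors hξ hloc
  have hbim : IsSubBimodule B V := S.isSubBimodule_localizedVectors _
  obtain ⟨k, hk1, hk2, hk3⟩ := B.exists_trace_density hτ hf
  let e := Module.finBasis ℂ V
  let W : AddSubgroup Y := V.toAddSubgroup.map (J : X →+ Y)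
  have hJB : ∀ v ∈ V, ∀ w ∈ V, Y.inner (J v) (J w) ∈ B := fun v hv w hw =>
    Localized.inner_mem (Localized.conjugation hv J) (Localized.conjugation hw J)
  obtain ⟨m, y, hyW, hyy, hye⟩ := Y.exists_gramSchmidt B hB W
    (by
      rintro _ ⟨v, hv, rfl⟩ b hb
      refine ⟨star b • v, hbim.smul_mem _ (star_mem hb) v hv, ?_⟩
      change J (star b • v) = op b • J v
      rw [J.map_smul_left, star_star])
    (by
      rintro _ ⟨v, hv, rfl⟩ _ ⟨w, hw, rfl⟩
      exact hJB v hv w hw)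
    (fun i => J (e i : X)) (fun i => ⟨e i, (e i).2, rfl⟩)
  choose x hxV hxy using hyW
  obtain rfl : y = fun j => J (x j) := funext fun j => (hxy j).symm
  have hgen (v : X) (hv : v ∈ V) :
      Y.ketBra (fun j => J (x j)) (fun j => J (x j)) (J v) = J v := by
    have hsum : v = ∑ i, (e.repr ⟨v, hv⟩ i • (1 : A)) • (e i : X) := by
      have := congrArg Subtype.val (e.sum_repr ⟨v, hv⟩)
      rw [AddSubmonoidClass.coe_finsetSum] at this
      simp_rw [← complex_smul_eq_left]
      exact this.symm
    rw [hsum, map_sum, map_sum]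
    refine Finset.sum_congr rfl fun i _ => ?_
    rw [J.map_smul_left, ketBra_op_smul, hye]
  refine ⟨k, m, _, hk3, fun j => Localized.conjugation (hxV j) J, hyy, hgen, ?_⟩
  -- Both sides are the operator trace of `v ↦ k v k` on `V`.
  rw [← hbim.trace_bimul_left J hJB hk2 hxV hgen k,
    ← hbim.trace_bimul_right hk1 hloc (fun v _ => (X.isProjectiveBasis_iff ξ).1 hξ v) k]

end Conjugate

end SpinChain

/-! ### The dual of a DHR bimodule -/

lemma Correspondence.IsDual.symm {A : Type u} [CStarAlgebra A] {X Y : Correspondence A}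
    (h : X.IsDual Y) : Y.IsDual X := by
  obtain ⟨YX, XY, P, Q, h1, h2⟩ := h
  exact ⟨XY, YX, Q, P, h2, h1⟩

open Correspondence SpinChain in
theorem mainTheorem11 {A : Type u} [CStarAlgebra A] (S : SpinChain A)
    (K R L : ℕ) (hL : 0 < L)
    (hHaag : S.WeakHaagDuality K R)
    (hCovering : S.CoveringProperty L)
    (hSimple : StronglySimple A)
    (hTransporter : S.ChargeTransporterGeneration (R + L))
    (X : Correspondence A) (hX : S.IsDHR X)
    (Xbar : Correspondence A) (hXbar : X.IsDual Xbar) :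
    S.IsDHR Xbar := by
  refine ⟨⟨X, hXbar.symm⟩, ?_⟩
  obtain ⟨YX, XY, P, Q, h, h'⟩ := hXbar
  obtain ⟨-, r, hr⟩ := hX
  obtain ⟨hsimple, τ, hτ, huniq⟩ := hSimple
  have hf : ∀ a, τ (star a * a) = 0 → a = 0 := fun a => hτ.faithful
  let J := conjugation h
  have hsites (n : ℕ) : numSites (symmInterval n) = 2 * n + 1 := by
    change (n : ℤ) - -(n : ℤ) + 1 = _
    ring
  obtain ⟨n₀, ξ₀, hξ₀, hloc₀⟩ := hr (symmInterval r) (by rw [hsites]; lia)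
  obtain ⟨m, x, hx, hgen⟩ := exists_generators h h' _ (S.dense_boundedVectors hξ₀ hloc₀)
  choose N hN using hx
  -- One interval that contains the localization regions of all generators and is long enough for
  -- localized bases of `X` and for Haag duality.
  set M := r + K + ∑ k, N k with hM
  have hNM (k : Fin m) : N k ≤ M :=
    (Finset.single_le_sum (fun i _ => Nat.zero_le (N i)) (Finset.mem_univ k)).trans (by lia)
  obtain ⟨n₁, ξ₁, hξ₁, hloc₁⟩ := hr (symmInterval M) (by rw [hsites]; lia)
  obtain ⟨k₁, m₁, z, hk₁, -, hzz, hz, htr₁⟩ :=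
    S.exists_localized_family hHaag hτ hf J (by rw [hsites]; lia) hξ₁ hloc₁
  have hzbasis : Xbar.IsProjectiveBasis z := by
    rw [isProjectiveBasis_iff]
    intro v
    obtain ⟨a, rfl⟩ := hgen v
    rw [map_sum]
    refine Finset.sum_congr rfl fun k _ => ?_
    rw [ketBra_op_smul]
    congr 1
    exact hz _ (Localized.mono (symmInterval_mono (hNM k)) (hN k))
  obtain ⟨d, hd⟩ := exists_basisTrace_eq_smul hτ huniq hξ₁
  obtain ⟨d', hd'⟩ := exists_basisTrace_eq_smul hτ huniq hzbasis
  -- The two functionals agree at `k₁`, where `τ` is nonzero by strict positivity of `k₁`.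
  have hdd : d' = d := by
    have hne : τ k₁ ≠ 0 := fun h0 =>
      one_ne_zero (hτ.map_one.symm.trans (hk₁ τ hτ.isPositiveFunctional h0))
    rw [hd, hd'] at htr₁
    exact mul_right_cancel₀ hne htr₁
  refine ⟨max r K, fun I hI => ?_⟩
  obtain ⟨n, ξ, hξ, hloc⟩ := hr I (by lia)
  obtain ⟨k, m', y, hk, hyloc, hyy, -, htr⟩ :=
    S.exists_localized_family hHaag hτ hf J (by lia) hξ hloc
  refine ⟨m', y, isProjectiveBasis_of_basisTrace_one hτ hf hzbasis hyy ?_, hyloc⟩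
  -- The positive functional `φ_z - φ_y` vanishes at `k`, since `φ_z k = d τ k = φ_ξ k = φ_y k`.
  refine hk _ (fun a => ?_) ?_
  · rw [LinearMap.sub_apply, basisTrace_sub_basisTrace hτ hzbasis hyy]
    choose t ht0 ht using fun i => exists_map_inner_self hτ.isPositiveFunctional
      (star a • z i - Xbar.ketBra y y (star a • z i))
    exact ⟨∑ i, t i, Finset.sum_nonneg fun i _ => ht0 i, by simp_rw [ht, Complex.ofReal_sum]⟩
  · rw [LinearMap.sub_apply, htr, hd', hdd, ← hd, basisTrace_eq_basisTrace hτ hξ hξ₁, sub_self]
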